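/- **Setting.** Let $g_b>0$, $0<h_1<h_2$, $\rho^p,\rho^s,C^p,C^s,G^p,G^s,\varepsilon_{33},\mu>0$ and $\gamma\in\mathbb R$ (mass densities $\rho$, stiffnesses $C$, shear moduli $G$, piezoelectric constant $\gamma$, permittivity $\varepsilon_{33}$, permeability $\mu$) be the constants of a two-layer piezoelectric composite beam of length $1$ (substrate $-h_1\le z_3\le h_1$, piezoelectric layer $h_1\le z_3\le h_2$, width $2g_b$). Put $$A^p=2g_b(h_2-h_1),\quad A^s=4g_bh_1,\quad I^p=\tfrac23g_b(h_2^3-h_1^3),\quad I^s=\tfrac43g_bh_1^3,\quad I_0^p=g_b(h_2^2-h_1^2),$$ $$\rho_A=\rho^pA^p+\rho^sA^s,\quad \rho_I=\rho^pI^p+\rho^sI^s,\quad \rho_{I_0}=\rho^pI^p_0,\quad C_A=C^pA^p+C^sA^s,\quad C_I=C^pI^p+C^sI^s,\quad C_{I_0}=C^pI_0^p,\quad G_A=G^sA^s+G^pA^p .$$ Let $H^1_0(0,1)=\{f\in H^1(0,1): f(0)=0\}$ and let $\mathcal X_T=H^1_0(0,1)^4\times L^2(0,1)^4$ (real-valued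 functions), with states $\mathbf x=(x_1,\dots,x_8)=(v,\phi,w,\Phi,\dot v,\dot\phi,\dot w,\dot\Phi)$ and inner product $$\langle \mathbf x,\mathbf y\rangle=\int_0^1\Big[C_Ax_1'y_1'+C_Ix_2'y_2'-C_{I_0}(x_1'y_2'+x_2'y_1')+\tfrac12G_A(x_3'-x_2)(y_3'-y_2)+\tfrac1\mu A^px_4'y_4'+\rho_Ax_5y_5+\rho_Ix_6y_6-\rho_{I_0}(x_5y_6+x_6y_5)+\rho_Ax_7y_7+\varepsilon_{33}A^px_8y_8\Big]dz ,$$ so that $\|\mathbf x\|^2=2\mathcal H_T$ is twice the total energy. Let $d=\rho_A\rho_I-\rho_{I_0}^2$ (which is positive) and $$a_{51}=\tfrac{\rho_IC_A-\rho_{I_0}C_{I_0}}d,\quad a_{52}=\tfrac{\rho_IC_{I_0}-\rho_{I_0}C_I}d,\quad a_{53}=\tfrac{\rho_{I_0}G_A}{2d},\quad a_{58}=\gamma\tfrac{\rho_IA^p-\rho_{I_0}I_0^p}d,$$ $$a_{61}=\tfrac{\rho_AC_{I_0}-\rho_{I_0}C_A}d,\quad a_{62}=\tfrac{\rho_AC_I-\rho_{I_0}C_{I_0}}d,\quad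 a_{63}=\tfrac{\rho_AG_A}{2d},\quad a_{68}=\gamma\tfrac{\rho_AI_0^p-\rho_{I_0}A^p}d,$$ $$a_7=\tfrac{G_A}{2\rho_A},\quad a_{84}=\tfrac1{\varepsilon_{33}\mu},\quad a_{85}=\tfrac{\gamma}{\varepsilon_{33}},\quad a_{86}=\tfrac{\gamma I_0^p}{\varepsilon_{33}A^p}.$$ Define $\mathcal A_T:\operatorname{Dom}(\mathcal A_T)\subset\mathcal X_T\to\mathcal X_T$ by $$\mathcal A_T\mathbf x=\begin{pmatrix}x_5\\x_6\\x_7\\x_8\\ a_{51}x_1''-a_{52}x_2''-a_{53}x_2+a_{53}x_3'-a_{58}x_8'\\ -a_{61}x_1''+a_{62}x_2''-a_{63}x_2+a_{63}x_3'+a_{68}x_8'\\ -a_7x_2'+a_7x_3''\\ a_{84}x_4''-a_{85}x_5'+a_{86}x_6'\end{pmatrix},$$ where $\operatorname{Dom}(\mathcal A_T)$ is the set of all $\mathbf x\in\mathcal X_T$ with $x_1,\dots,x_4\in H^2(0,1)$, $x_5,\dots,x_8\in H^1_0(0,1)$ and $$C_Ax_1'(1)-C_{I_0}x_2'(1)-\gamma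 A^px_8(1)=0,\quad C_Ix_2'(1)-C_{I_0}x_1'(1)+\gamma I_0^px_8(1)=0,\quad \tfrac{G_A}2\big(x_3'(1)-x_2(1)\big)=0,\quad \tfrac1\mu A^px_4'(1)=0 .$$ **Theorem.** $\mathcal X_T$ is a Hilbert space, and $\mathcal A_T$ is the infinitesimal generator of a strongly continuous semigroup $(T(t))_{t\ge0}$ of contractions on $\mathcal X_T$, i.e. $\|T(t)\|\le1$ for all $t\ge0$. -/

import Mathlib

noncomputable section

open MeasureTheory Set Filter Topology
open scoped ContDiff NNReal

namespace PiezoBeam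

/-- The real Hilbert space `L²(0,1)`. -/
abbrev L2 : Type := Lp ℝ 2 (volume.restrict (Ioo (0 : ℝ) 1))

/-- `g ∈ L²(0,1)` is the weak (distributional) derivative of `f ∈ L²(0,1)` on `(0,1)`. -/
def HasWeakDeriv (f g : L2) : Prop :=
  ∀ φ : ℝ → ℝ, ContDiff ℝ ∞ φ → HasCompactSupport φ → tsupport φ ⊆ Ioo 0 1 →
    ∫ z in Ioo (0 : ℝ) 1, f z * deriv φ z = - ∫ z in Ioo (0 : ℝ) 1, g z * φ z

lemma integrable_coe (f : L2) : Integrable f (volume.restrict (Ioo (0 : ℝ) 1)) :=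
  (Lp.memLp f).integrable (by norm_num)

lemma integrable_mul_test (f : L2) {φ : ℝ → ℝ} (hφ : Continuous φ) (hc : HasCompactSupport φ) :
    Integrable (fun z => f z * φ z) (volume.restrict (Ioo (0 : ℝ) 1)) := by
  obtain ⟨C, hC⟩ := hφ.bounded_above_of_compact_support hc
  exact (integrable_coe f).mul_bdd hφ.aestronglyMeasurable (Eventually.of_forall hC)

lemma HasWeakDeriv.add {f g f' g' : L2} (hf : HasWeakDeriv f f') (hg : HasWeakDeriv g g') :
    HasWeakDeriv (f + g) (f' + g') := by
  intro φ h1 h2 h3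
  have hd : Continuous (deriv φ) := h1.continuous_deriv (by simp)
  have e1 : ∫ z in Ioo (0 : ℝ) 1, (f + g : L2) z * deriv φ z
      = ∫ z in Ioo (0 : ℝ) 1, (f z * deriv φ z + g z * deriv φ z) := by
    apply integral_congr_ae
    filter_upwards [Lp.coeFn_add f g] with z hz
    rw [hz, Pi.add_apply]; ring
  have e2 : ∫ z in Ioo (0 : ℝ) 1, (f' + g' : L2) z * φ z
      = ∫ z in Ioo (0 : ℝ) 1, (f' z * φ z + g' z * φ z) := by
    apply integral_congr_ae
    filter_upwards [Lp.coeFn_add f' g'] with z hz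
    rw [hz, Pi.add_apply]; ring
  rw [e1, e2, integral_add (integrable_mul_test f hd h2.deriv) (integrable_mul_test g hd h2.deriv),
    integral_add (integrable_mul_test f' h1.continuous h2)
      (integrable_mul_test g' h1.continuous h2), hf φ h1 h2 h3, hg φ h1 h2 h3]
  ring

lemma HasWeakDeriv.smul {f f' : L2} (c : ℝ) (hf : HasWeakDeriv f f') :
    HasWeakDeriv (c • f) (c • f') := by
  intro φ h1 h2 h3
  have e1 : ∫ z in Ioo (0 : ℝ) 1, (c • f : L2) z * deriv φ z
      = ∫ z in Ioo (0 : ℝ) 1, c * (f z * deriv φ z) := by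
    apply integral_congr_ae
    filter_upwards [Lp.coeFn_smul c f] with z hz
    rw [hz, Pi.smul_apply, smul_eq_mul]; ring
  have e2 : ∫ z in Ioo (0 : ℝ) 1, (c • f' : L2) z * φ z
      = ∫ z in Ioo (0 : ℝ) 1, c * (f' z * φ z) := by
    apply integral_congr_ae
    filter_upwards [Lp.coeFn_smul c f'] with z hz
    rw [hz, Pi.smul_apply, smul_eq_mul]; ring
  rw [e1, e2, integral_const_mul, integral_const_mul, hf φ h1 h2 h3]
  ring

lemma hasWeakDeriv_zero : HasWeakDeriv 0 0 := by
  have h : ∀ φ : ℝ → ℝ, ∫ z in Ioo (0 : ℝ) 1, (0 : L2) z * φ z = 0 := by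
    intro φ
    apply integral_eq_zero_of_ae
    filter_upwards [Lp.coeFn_zero ℝ 2 (volume.restrict (Ioo (0 : ℝ) 1))] with z hz
    rw [hz]; simp
  intro φ _ _ _
  rw [h, h, neg_zero]

/-- A function that annihilates all test functions on `(0,1)` vanishes almost everywhere. -/
lemma ae_zero_of_test {u : ℝ → ℝ} (hu : Integrable u (volume.restrict (Ioo (0 : ℝ) 1)))
    (h : ∀ φ : ℝ → ℝ, ContDiff ℝ ∞ φ → HasCompactSupport φ → tsupport φ ⊆ Ioo 0 1 →
      ∫ z in Ioo (0 : ℝ) 1, u z * φ z = 0) :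
    u =ᵐ[volume.restrict (Ioo (0 : ℝ) 1)] 0 := by
  have := isOpen_Ioo.ae_eq_zero_of_integral_contDiff_smul_eq_zero
    (U := Ioo (0 : ℝ) 1) (μ := volume) (f := u) (IntegrableOn.locallyIntegrableOn hu) ?_
  · exact (ae_restrict_iff' measurableSet_Ioo).2 this
  · intro φ h1 h2 h3
    rw [← h φ h1 h2 h3, ← setIntegral_eq_integral_of_forall_compl_eq_zero (s := Ioo (0 : ℝ) 1)]
    · exact integral_congr_ae (Eventually.of_forall fun z => by simp [mul_comm])
    · intro z hz
      rw [image_eq_zero_of_notMem_tsupport (fun hz' => hz (h3 hz')), zero_smul]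

lemma HasWeakDeriv.unique {f g g' : L2} (h : HasWeakDeriv f g) (h' : HasWeakDeriv f g') :
    g = g' := by
  have key := ae_zero_of_test (u := fun z => g z - g' z)
    ((integrable_coe g).sub (integrable_coe g')) ?_
  · apply Lp.ext
    filter_upwards [key] with z hz
    simpa [sub_eq_zero] using hz
  · intro φ h1 h2 h3
    have e := (h φ h1 h2 h3).symm.trans (h' φ h1 h2 h3)
    simp only [sub_mul]
    rw [integral_sub (integrable_mul_test g h1.continuous h2)
      (integrable_mul_test g' h1.continuous h2)]
    linarith

/-- The primitive of a mean-free test function is a test function. -/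
lemma exists_test_primitive {θ : ℝ → ℝ} (h1 : ContDiff ℝ ∞ θ) (h2 : HasCompactSupport θ)
    (h3 : tsupport θ ⊆ Ioo 0 1) (h4 : ∫ z, θ z = 0) :
    ∃ η : ℝ → ℝ, ContDiff ℝ ∞ η ∧ HasCompactSupport η ∧ tsupport η ⊆ Ioo 0 1 ∧ deriv η = θ := by
  obtain ⟨a, b, ha, hb, hab⟩ : ∃ a b : ℝ, 0 < a ∧ b < 1 ∧ tsupport θ ⊆ Icc a b := by
    rcases (tsupport θ).eq_empty_or_nonempty with he | hne
    · exact ⟨1, 0, by norm_num, by norm_num, by simp [he]⟩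
    · obtain ⟨a, haK, ha⟩ := IsCompact.exists_isLeast h2 hne
      obtain ⟨b, hbK, hb⟩ := IsCompact.exists_isGreatest h2 hne
      exact ⟨a, b, (h3 haK).1, (h3 hbK).2, fun z hz => ⟨ha hz, hb hz⟩⟩
  have hout : ∀ z, z ∉ Icc a b → θ z = 0 := fun z hz =>
    image_eq_zero_of_notMem_tsupport fun h => hz (hab h)
  have hder : ∀ z, HasDerivAt (fun z => ∫ t in (0 : ℝ)..z, θ t) (θ z) z := fun z =>
    h1.continuous.integral_hasStrictDerivAt 0 z |>.hasDerivAt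
  have hderiv : deriv (fun z => ∫ t in (0 : ℝ)..z, θ t) = θ := funext fun z => (hder z).deriv
  have hsupp : tsupport (fun z => ∫ t in (0 : ℝ)..z, θ t) ⊆ Icc a b := by
    apply closure_minimal _ isClosed_Icc
    intro z hz
    by_contra hzn
    apply hz
    rw [mem_Icc, not_and_or, not_le, not_le] at hzn
    rcases hzn with hzn | hzn
    · apply intervalIntegral.integral_zero_ae
      refine Eventually.of_forall fun t ht => hout t fun hta => ?_
      have := ht.2
      have h5 := hta.1
      rcases max_cases (0 : ℝ) z with h | h <;> linarith
    · change ∫ t in (0 : ℝ)..z, θ t = 0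
      rw [intervalIntegral.integral_eq_integral_of_support_subset, h4]
      intro t ht
      have := hab (subset_tsupport _ ht)
      exact ⟨by linarith [this.1], by linarith [this.2]⟩
  refine ⟨_, ?_, HasCompactSupport.of_support_subset_isCompact isCompact_Icc
    ((subset_tsupport _).trans hsupp), hsupp.trans fun z hz => ⟨by linarith [hz.1], by linarith [hz.2]⟩,
    hderiv⟩
  rw [contDiff_infty_iff_deriv]
  exact ⟨fun z => (hder z).differentiableAt, by rwa [hderiv]⟩

lemma intervalIntegrable_coe (g : L2) : IntervalIntegrable g volume 0 1 := by
  rw [intervalIntegrable_iff_integrableOn_Ioo_of_le zero_le_one]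
  exact integrable_coe g

lemma continuousOn_primitive (g : L2) :
    ContinuousOn (fun z => ∫ t in (0 : ℝ)..z, g t) (Icc 0 1) := by
  have := ((intervalIntegrable_coe g).absolutelyContinuousOnInterval_intervalIntegral
    (c := 0) (by simp)).continuousOn
  rwa [uIcc_of_le zero_le_one] at this

/-- Integration by parts of a primitive against a test function. -/
lemma integral_primitive_mul_deriv (g : L2) {η : ℝ → ℝ} (h1 : ContDiff ℝ ∞ η)
    (h3 : tsupport η ⊆ Ioo 0 1) :
    ∫ z in Ioo (0 : ℝ) 1, (∫ t in (0 : ℝ)..z, g t) * deriv η z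
      = - ∫ z in Ioo (0 : ℝ) 1, g z * η z := by
  have hac := (intervalIntegrable_coe g).absolutelyContinuousOnInterval_intervalIntegral
    (c := 0) (by simp)
  have hη : AbsolutelyContinuousOnInterval η 0 1 :=
    (h1.of_le (by simp)).contDiffOn.absolutelyContinuousOnInterval
  have h := hac.integral_mul_deriv_eq_deriv_mul hη
  have e0 : η 1 = 0 := image_eq_zero_of_notMem_tsupport fun h => by simpa using h3 h
  have e1 : ∫ z in (0 : ℝ)..1, deriv (fun z => ∫ t in (0 : ℝ)..z, g t) z * η z
      = ∫ z in (0 : ℝ)..1, g z * η z := by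
    apply intervalIntegral.integral_congr_ae
    filter_upwards [(intervalIntegrable_coe g).ae_hasDerivAt_integral] with z hz hz'
    rw [(hz (uIoc_subset_uIcc hz') 0 (by simp)).deriv]
  rw [e1, e0] at h
  rw [← integral_Ioc_eq_integral_Ioo, ← integral_Ioc_eq_integral_Ioo,
    ← intervalIntegral.integral_of_le zero_le_one, ← intervalIntegral.integral_of_le zero_le_one, h]
  simp

/-- A function with a weak derivative is a.e. equal to a constant plus the primitive of it. -/
lemma HasWeakDeriv.ae_eq_primitive {f g : L2} (h : HasWeakDeriv f g) :
    ∃ c : ℝ, f =ᵐ[volume.restrict (Ioo (0 : ℝ) 1)] fun z => c + ∫ t in (0 : ℝ)..z, g t := by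
  let ρ : ContDiffBump (1 / 2 : ℝ) := ⟨1 / 8, 1 / 4, by norm_num, by norm_num⟩
  let r : ℝ → ℝ := ρ.normed volume
  have r1 : ContDiff ℝ ∞ r := ρ.contDiff_normed
  have r2 : HasCompactSupport r := ρ.hasCompactSupport_normed
  have r3 : tsupport r ⊆ Ioo 0 1 := by
    intro z hz
    have hz' : z ∈ Metric.closedBall (1 / 2 : ℝ) (1 / 4) := by
      have := ρ.tsupport_normed_eq (μ := volume)
      rw [show tsupport r = _ from this] at hz
      exact hz
    rw [Real.closedBall_eq_Icc] at hz'
    exact ⟨by linarith [hz'.1], by linarith [hz'.2]⟩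
  have r4 : ∫ z, r z = 1 := ρ.integral_normed
  let G : ℝ → ℝ := fun z => ∫ t in (0 : ℝ)..z, g t
  have hGint : Integrable G (volume.restrict (Ioo (0 : ℝ) 1)) :=
    ((continuousOn_primitive g).integrableOn_Icc).mono_set Ioo_subset_Icc_self
  let u : ℝ → ℝ := fun z => f z - G z
  have hu : Integrable u (volume.restrict (Ioo (0 : ℝ) 1)) := (integrable_coe f).sub hGint
  have hmul : ∀ {w : ℝ → ℝ}, Integrable w (volume.restrict (Ioo (0 : ℝ) 1)) → ∀ {φ : ℝ → ℝ},
      Continuous φ → HasCompactSupport φ →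
      Integrable (fun z => w z * φ z) (volume.restrict (Ioo (0 : ℝ) 1)) := by
    intro w hw φ hφ hc
    obtain ⟨C, hC⟩ := hφ.bounded_above_of_compact_support hc
    exact hw.mul_bdd hφ.aestronglyMeasurable (Eventually.of_forall hC)
  let c : ℝ := ∫ z in Ioo (0 : ℝ) 1, u z * r z
  refine ⟨c, ?_⟩
  have key := ae_zero_of_test (u := fun z => u z - c) (hu.sub (integrable_const c)) ?_
  · filter_upwards [key] with z hz
    have : f z - G z - c = 0 := hz
    change f z = c + G z
    linarith
  · intro ψ p1 p2 p3
    let m : ℝ := ∫ z, ψ z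
    have pm : ∫ z in Ioo (0 : ℝ) 1, ψ z = m :=
      setIntegral_eq_integral_of_forall_compl_eq_zero fun z hz =>
        image_eq_zero_of_notMem_tsupport fun hz' => hz (p3 hz')
    obtain ⟨η, q1, q2, q3, q4⟩ := exists_test_primitive (θ := fun z => ψ z - m * r z)
      (p1.sub (contDiff_const.mul r1)) (p2.sub r2.mul_left)
      ((tsupport_sub ψ _).trans (union_subset p3
        ((tsupport_mul_subset_right (f := fun _ => m) (g := r)).trans r3)))
      (by
        rw [integral_sub (p1.continuous.integrable_of_hasCompactSupport p2)
          ((r1.continuous.integrable_of_hasCompactSupport r2).const_mul m), integral_const_mul, r4]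
        simp [m])
    have a1 := h η q1 q2 q3
    have a2 := integral_primitive_mul_deriv g q1 q3
    rw [← a2] at a1
    have a3 : ∫ z in Ioo (0 : ℝ) 1, u z * deriv η z = 0 := by
      simp only [u, sub_mul]
      have hd : Continuous (deriv η) := q1.continuous_deriv (by simp)
      rw [integral_sub (hmul (integrable_coe f) hd q2.deriv) (hmul hGint hd q2.deriv)]
      exact sub_eq_zero.2 a1
    rw [q4] at a3
    have a4 : ∫ z in Ioo (0 : ℝ) 1, u z * (ψ z - m * r z)
        = (∫ z in Ioo (0 : ℝ) 1, u z * ψ z) - m * c := by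
      rw [← integral_const_mul, ← integral_sub (hmul hu p1.continuous p2)
        ((hmul hu r1.continuous r2).const_mul m)]
      exact integral_congr_ae (Eventually.of_forall fun z => by ring)
    simp only [sub_mul]
    rw [integral_sub (hmul hu p1.continuous p2)
      ((p1.continuous.integrable_of_hasCompactSupport p2).integrableOn.const_mul c),
      integral_const_mul, pm]
    linarith

/-- `F` is a representative of `f ∈ L²(0,1)` that is continuous on `[0,1]`. -/
def IsContRep (f : L2) (F : ℝ → ℝ) : Prop :=
  ContinuousOn F (Icc 0 1) ∧ f =ᵐ[volume.restrict (Ioo (0 : ℝ) 1)] F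

open Classical in
/-- The pointwise value `f(z)`, `z ∈ [0,1]`, of the continuous representative of `f`
(`0` if there is no continuous representative; every `f ∈ H¹(0,1)` has one). -/
def trace (f : L2) (z : ℝ) : ℝ :=
  if h : ∃ F, IsContRep f F then h.choose z else 0

lemma IsContRep.trace_eq {f : L2} {F : ℝ → ℝ} (h : IsContRep f F) {z : ℝ} (hz : z ∈ Icc (0 : ℝ) 1) :
    trace f z = F z := by
  have hex : ∃ F, IsContRep f F := ⟨F, h⟩
  rw [trace, dif_pos hex]
  have hs := hex.choose_spec
  refine Measure.eqOn_Icc_of_ae_eq (μ := volume) zero_ne_one ?_ hs.1 h.1 hz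
  rw [← restrict_Ioo_eq_restrict_Icc]
  exact hs.2.symm.trans h.2

/-- The Sobolev space `H¹(0,1)`. -/
def H1 : Submodule ℝ L2 where
  carrier := {f | ∃ g, HasWeakDeriv f g}
  add_mem' := fun ⟨_, hf⟩ ⟨_, hg⟩ => ⟨_, hf.add hg⟩
  zero_mem' := ⟨0, hasWeakDeriv_zero⟩
  smul_mem' := fun c _ ⟨_, hf⟩ => ⟨_, hf.smul c⟩

lemma H1.exists_contRep {f : L2} (hf : f ∈ H1) : ∃ F, IsContRep f F := by
  obtain ⟨g, hg⟩ := hf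
  obtain ⟨c, hc⟩ := hg.ae_eq_primitive
  exact ⟨_, continuousOn_const.add (continuousOn_primitive g), hc⟩

lemma trace_add {f g : L2} (hf : f ∈ H1) (hg : g ∈ H1) {z : ℝ} (hz : z ∈ Icc (0 : ℝ) 1) :
    trace (f + g) z = trace f z + trace g z := by
  obtain ⟨F, hF⟩ := H1.exists_contRep hf
  obtain ⟨G, hG⟩ := H1.exists_contRep hg
  have : IsContRep (f + g) (F + G) := ⟨hF.1.add hG.1, by
    filter_upwards [Lp.coeFn_add f g, hF.2, hG.2] with z h1 h2 h3
    rw [h1, Pi.add_apply, h2, h3, Pi.add_apply]⟩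
  rw [this.trace_eq hz, hF.trace_eq hz, hG.trace_eq hz, Pi.add_apply]

lemma trace_smul {f : L2} (hf : f ∈ H1) (c : ℝ) {z : ℝ} (hz : z ∈ Icc (0 : ℝ) 1) :
    trace (c • f) z = c * trace f z := by
  obtain ⟨F, hF⟩ := H1.exists_contRep hf
  have : IsContRep (c • f) (c • F) := ⟨hF.1.const_smul c, by
    filter_upwards [Lp.coeFn_smul c f, hF.2] with z h1 h2
    rw [h1, Pi.smul_apply, h2, Pi.smul_apply]⟩
  rw [this.trace_eq hz, hF.trace_eq hz, Pi.smul_apply, smul_eq_mul]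

lemma trace_zero {z : ℝ} (hz : z ∈ Icc (0 : ℝ) 1) : trace 0 z = 0 := by
  simpa using trace_smul (H1.zero_mem) 0 hz

/-- `H¹₀(0,1) = {f ∈ H¹(0,1) | f(0) = 0}` (the condition is imposed at the left end only). -/
def H10 : Submodule ℝ L2 where
  carrier := {f | f ∈ H1 ∧ trace f 0 = 0}
  add_mem' := fun ⟨hf, hf0⟩ ⟨hg, hg0⟩ =>
    ⟨H1.add_mem hf hg, by rw [trace_add hf hg (by simp), hf0, hg0, add_zero]⟩
  zero_mem' := ⟨H1.zero_mem, trace_zero (by simp)⟩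
  smul_mem' := fun c _ ⟨hf, hf0⟩ =>
    ⟨H1.smul_mem c hf, by rw [trace_smul hf c (by simp), hf0, mul_zero]⟩

open Classical in
/-- The weak derivative `f' = ∂_z f` of `f ∈ H¹(0,1)` (and `0` if `f ∉ H¹(0,1)`). -/
def wd (f : L2) : L2 := if h : ∃ g, HasWeakDeriv f g then h.choose else 0

lemma HasWeakDeriv.wd_eq {f g : L2} (h : HasWeakDeriv f g) : wd f = g := by
  have hex : ∃ g, HasWeakDeriv f g := ⟨g, h⟩
  rw [wd, dif_pos hex]
  exact hex.choose_spec.unique h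

lemma wd_add {f g : L2} (hf : f ∈ H1) (hg : g ∈ H1) : wd (f + g) = wd f + wd g := by
  obtain ⟨f', hf⟩ := hf
  obtain ⟨g', hg⟩ := hg
  rw [(hf.add hg).wd_eq, hf.wd_eq, hg.wd_eq]

lemma wd_smul {f : L2} (hf : f ∈ H1) (c : ℝ) : wd (c • f) = c • wd f := by
  obtain ⟨f', hf⟩ := hf
  rw [(hf.smul c).wd_eq, hf.wd_eq]

lemma wd_zero : wd 0 = 0 := hasWeakDeriv_zero.wd_eq

lemma eq_zero_of_wd_eq_zero {f : L2} (hf : f ∈ H10) (h : wd f = 0) : f = 0 := by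
  obtain ⟨⟨g, hg⟩, h0⟩ := hf
  obtain rfl : g = 0 := hg.wd_eq.symm.trans h
  obtain ⟨c, hc⟩ := hg.ae_eq_primitive
  have hrep : IsContRep f _ := ⟨continuousOn_const.add (continuousOn_primitive 0), hc⟩
  have hc0 : c = 0 := by
    have := hrep.trace_eq (z := 0) (by simp)
    simpa [h0] using this.symm
  have hz : ∀ z ∈ Icc (0 : ℝ) 1, ∫ t in (0 : ℝ)..z, (0 : L2) t = 0 := by
    intro z hz
    rw [intervalIntegral.integral_of_le hz.1]
    apply integral_eq_zero_of_ae
    have h1 : ∀ᵐ t ∂(volume.restrict (Ioc (0 : ℝ) 1)), (0 : L2) t = 0 := by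
      rw [← restrict_Ioo_eq_restrict_Ioc]
      exact Lp.coeFn_zero ℝ 2 (volume.restrict (Ioo (0 : ℝ) 1))
    exact ae_restrict_of_ae_restrict_of_subset (Ioc_subset_Ioc_right hz.2) h1
  apply Lp.ext
  filter_upwards [hc, Lp.coeFn_zero ℝ 2 (volume.restrict (Ioo (0 : ℝ) 1)),
    ae_restrict_mem measurableSet_Ioo] with z h1 h2 h3
  rw [h1, hc0, hz z (Ioo_subset_Icc_self h3), h2]
  simp

/-- The physical and geometrical constants of the composite: half-width `gb`, layer interfaces
`-h₁, h₁, h₂` (substrate `-h₁ ≤ z₃ ≤ h₁`, piezoelectric layer `h₁ ≤ z₃ ≤ h₂`), mass densities `ρ`,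
stiffnesses `C₁₁`, shear moduli `G` of the piezoelectric layer (`p`) and the substrate (`s`),
piezoelectric constant `γ`, permittivity `ε₃₃` and magnetic permeability `μ`. -/
structure BeamParams where
  gb : ℝ
  h₁ : ℝ
  h₂ : ℝ
  ρp : ℝ
  ρs : ℝ
  Cp : ℝ
  Cs : ℝ
  Gp : ℝ
  Gs : ℝ
  γ : ℝ
  ε : ℝ
  μ : ℝ
  gb_pos : 0 < gb
  h₁_pos : 0 < h₁
  h₁_lt_h₂ : h₁ < h₂
  ρp_pos : 0 < ρp
  ρs_pos : 0 < ρs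
  Cp_pos : 0 < Cp
  Cs_pos : 0 < Cs
  Gp_pos : 0 < Gp
  Gs_pos : 0 < Gs
  ε_pos : 0 < ε
  μ_pos : 0 < μ

namespace BeamParams

variable (p : BeamParams)

/-- Cross-sectional areas, second moments, and first moment of the two layers. -/
def Ap : ℝ := 2 * p.gb * (p.h₂ - p.h₁)
def As : ℝ := 2 * p.gb * (p.h₁ - (-p.h₁))
def Ip : ℝ := 2 / 3 * p.gb * (p.h₂ ^ 3 - p.h₁ ^ 3)
def Is : ℝ := 2 / 3 * p.gb * (p.h₁ ^ 3 - (-p.h₁) ^ 3)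
def I0p : ℝ := p.gb * (p.h₂ ^ 2 - p.h₁ ^ 2)

def ρA : ℝ := p.ρp * p.Ap + p.ρs * p.As
def ρI : ℝ := p.ρp * p.Ip + p.ρs * p.Is
def ρI0 : ℝ := p.ρp * p.I0p
def CA : ℝ := p.Cp * p.Ap + p.Cs * p.As
def CI : ℝ := p.Cp * p.Ip + p.Cs * p.Is
def CI0 : ℝ := p.Cp * p.I0p
def GA : ℝ := p.Gs * p.As + p.Gp * p.Ap

/-- The coefficients of the operator. -/
def a51 : ℝ := (p.ρI * p.CA - p.ρI0 * p.CI0) / (p.ρA * p.ρI - p.ρI0 ^ 2)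
def a52 : ℝ := (p.ρI * p.CI0 - p.ρI0 * p.CI) / (p.ρA * p.ρI - p.ρI0 ^ 2)
def a53 : ℝ := p.ρI0 * p.GA / (2 * (p.ρA * p.ρI - p.ρI0 ^ 2))
def a58 : ℝ := p.γ * ((p.ρI * p.Ap - p.ρI0 * p.I0p) / (p.ρA * p.ρI - p.ρI0 ^ 2))
def a61 : ℝ := (p.ρA * p.CI0 - p.ρI0 * p.CA) / (p.ρA * p.ρI - p.ρI0 ^ 2)
def a62 : ℝ := (p.ρA * p.CI - p.ρI0 * p.CI0) / (p.ρA * p.ρI - p.ρI0 ^ 2)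
def a63 : ℝ := p.ρA * p.GA / (2 * (p.ρA * p.ρI - p.ρI0 ^ 2))
def a68 : ℝ := p.γ * ((p.ρA * p.I0p - p.ρI0 * p.Ap) / (p.ρA * p.ρI - p.ρI0 ^ 2))
def a7 : ℝ := p.GA / (2 * p.ρA)
def a84 : ℝ := 1 / (p.ε * p.μ)
def a85 : ℝ := p.γ * (1 / p.ε)
def a86 : ℝ := p.γ * (p.I0p / (p.ε * p.Ap))

lemma h₂_pos : 0 < p.h₂ := p.h₁_pos.trans p.h₁_lt_h₂

lemma Ap_pos : 0 < p.Ap :=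
  mul_pos (mul_pos two_pos p.gb_pos) (sub_pos.2 p.h₁_lt_h₂)

lemma As_pos : 0 < p.As :=
  mul_pos (mul_pos two_pos p.gb_pos) (by linarith [p.h₁_pos])

lemma Is_pos : 0 < p.Is := by
  have h1 := p.gb_pos
  have h2 := p.h₁_pos
  have : p.Is = 4 / 3 * p.gb * p.h₁ ^ 3 := by unfold Is; ring
  rw [this]; positivity

lemma Ip_pos : 0 < p.Ip := by
  have h1 := p.gb_pos
  have h2 : p.h₁ ^ 3 < p.h₂ ^ 3 := pow_lt_pow_left₀ p.h₁_lt_h₂ p.h₁_pos.le (by norm_num)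
  exact mul_pos (by positivity) (sub_pos.2 h2)

lemma I0p_sq_lt : p.I0p ^ 2 < p.Ap * p.Ip := by
  have h1 := p.gb_pos
  have h2 := sub_pos.2 p.h₁_lt_h₂
  have : p.Ap * p.Ip - p.I0p ^ 2 = 1 / 3 * p.gb ^ 2 * (p.h₂ - p.h₁) ^ 4 := by
    unfold Ap Ip I0p; ring
  have h3 : 0 < 1 / 3 * p.gb ^ 2 * (p.h₂ - p.h₁) ^ 4 := by positivity
  linarith

lemma sq_lt_aux {c d : ℝ} (hc : 0 < c) (hd : 0 < d) :
    (c * p.I0p) ^ 2 < (c * p.Ap + d * p.As) * (c * p.Ip + d * p.Is) := by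
  have h1 := p.I0p_sq_lt
  have h2 := p.Ap_pos
  have h3 := p.As_pos
  have h4 := p.Is_pos
  have h5 := p.Ip_pos
  have h6 : c ^ 2 * p.I0p ^ 2 < c ^ 2 * (p.Ap * p.Ip) := by gcongr
  have h7 : 0 < c * p.Ap * (d * p.Is) + d * p.As * (c * p.Ip) + d * p.As * (d * p.Is) := by
    positivity
  nlinarith

lemma ρA_pos : 0 < p.ρA :=
  add_pos (mul_pos p.ρp_pos p.Ap_pos) (mul_pos p.ρs_pos p.As_pos)
lemma CA_pos : 0 < p.CA :=
  add_pos (mul_pos p.Cp_pos p.Ap_pos) (mul_pos p.Cs_pos p.As_pos)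
lemma GA_pos : 0 < p.GA :=
  add_pos (mul_pos p.Gs_pos p.As_pos) (mul_pos p.Gp_pos p.Ap_pos)
lemma ρI0_sq_lt : p.ρI0 ^ 2 < p.ρA * p.ρI := p.sq_lt_aux p.ρp_pos p.ρs_pos
lemma CI0_sq_lt : p.CI0 ^ 2 < p.CA * p.CI := p.sq_lt_aux p.Cp_pos p.Cs_pos

end BeamParams

/-- The state space `X_T = H¹₀(0,1)⁴ × L²(0,1)⁴`. -/
def StateSpace (_ : BeamParams) : Type := (Fin 4 → H10) × (Fin 4 → L2)

namespace StateSpace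

variable {p : BeamParams}

instance : AddCommGroup (StateSpace p) :=
  inferInstanceAs (AddCommGroup ((Fin 4 → H10) × (Fin 4 → L2)))
instance : Module ℝ (StateSpace p) := inferInstanceAs (Module ℝ ((Fin 4 → H10) × (Fin 4 → L2)))

/-- The components `x₁, …, x₈` of a state, that is `v, φ, w, Φ` and their velocities. -/
def x1 (x : StateSpace p) : L2 := x.1 0
def x2 (x : StateSpace p) : L2 := x.1 1
def x3 (x : StateSpace p) : L2 := x.1 2
def x4 (x : StateSpace p) : L2 := x.1 3
def x5 (x : StateSpace p) : L2 := x.2 0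
def x6 (x : StateSpace p) : L2 := x.2 1
def x7 (x : StateSpace p) : L2 := x.2 2
def x8 (x : StateSpace p) : L2 := x.2 3

section simps
variable (x y : StateSpace p) (c : ℝ)
@[simp] lemma x1_add : (x + y).x1 = x.x1 + y.x1 := rfl
@[simp] lemma x2_add : (x + y).x2 = x.x2 + y.x2 := rfl
@[simp] lemma x3_add : (x + y).x3 = x.x3 + y.x3 := rfl
@[simp] lemma x4_add : (x + y).x4 = x.x4 + y.x4 := rfl
@[simp] lemma x5_add : (x + y).x5 = x.x5 + y.x5 := rfl
@[simp] lemma x6_add : (x + y).x6 = x.x6 + y.x6 := rfl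
@[simp] lemma x7_add : (x + y).x7 = x.x7 + y.x7 := rfl
@[simp] lemma x8_add : (x + y).x8 = x.x8 + y.x8 := rfl
@[simp] lemma x1_smul : (c • x).x1 = c • x.x1 := rfl
@[simp] lemma x2_smul : (c • x).x2 = c • x.x2 := rfl
@[simp] lemma x3_smul : (c • x).x3 = c • x.x3 := rfl
@[simp] lemma x4_smul : (c • x).x4 = c • x.x4 := rfl
@[simp] lemma x5_smul : (c • x).x5 = c • x.x5 := rfl
@[simp] lemma x6_smul : (c • x).x6 = c • x.x6 := rfl
@[simp] lemma x7_smul : (c • x).x7 = c • x.x7 := rfl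
@[simp] lemma x8_smul : (c • x).x8 = c • x.x8 := rfl

lemma x1_mem : x.x1 ∈ H10 := (x.1 0).2
lemma x2_mem : x.x2 ∈ H10 := (x.1 1).2
lemma x3_mem : x.x3 ∈ H10 := (x.1 2).2
lemma x4_mem : x.x4 ∈ H10 := (x.1 3).2

lemma ext_comp {x y : StateSpace p} (h1 : x.x1 = y.x1) (h2 : x.x2 = y.x2) (h3 : x.x3 = y.x3)
    (h4 : x.x4 = y.x4) (h5 : x.x5 = y.x5) (h6 : x.x6 = y.x6) (h7 : x.x7 = y.x7)
    (h8 : x.x8 = y.x8) : x = y := by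
  refine Prod.ext (funext fun i => Subtype.ext ?_) (funext fun i => ?_)
  · fin_cases i
    exacts [h1, h2, h3, h4]
  · fin_cases i
    exacts [h5, h6, h7, h8]
end simps

/-- The energy inner product on the state space; here `inner ℝ f g = ∫₀¹ f g dz` in `L²(0,1)`. -/
def energyInner (x y : StateSpace p) : ℝ :=
  p.CA * inner ℝ (wd x.x1) (wd y.x1) + p.CI * inner ℝ (wd x.x2) (wd y.x2)
    - p.CI0 * (inner ℝ (wd x.x1) (wd y.x2) + inner ℝ (wd x.x2) (wd y.x1))
  + 1 / 2 * p.GA * (inner ℝ (wd x.x3) (wd y.x3) + inner ℝ x.x2 y.x2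
    - (inner ℝ (wd x.x3) y.x2 + inner ℝ x.x2 (wd y.x3)))
  + 1 / p.μ * p.Ap * inner ℝ (wd x.x4) (wd y.x4)
  + p.ρA * inner ℝ x.x5 y.x5 + p.ρI * inner ℝ x.x6 y.x6
    - p.ρI0 * (inner ℝ x.x5 y.x6 + inner ℝ x.x6 y.x5)
  + p.ρA * inner ℝ x.x7 y.x7 + p.ε * p.Ap * inner ℝ x.x8 y.x8

lemma quad_eq {E : Type*} [NormedAddCommGroup E] [InnerProductSpace ℝ E] {A B C : ℝ} (hA : 0 < A)
    (a b : E) : A * inner ℝ a a + B * inner ℝ b b - C * (inner ℝ a b + inner ℝ b a)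
      = A⁻¹ * (inner ℝ (A • a - C • b) (A • a - C • b) + (A * B - C ^ 2) * inner ℝ b b) := by
  simp only [inner_sub_left, inner_sub_right, inner_smul_left, inner_smul_right]
  simp only [real_inner_comm a b, conj_trivial]
  field_simp
  ring

lemma quad_nonneg {E : Type*} [NormedAddCommGroup E] [InnerProductSpace ℝ E] {A B C : ℝ}
    (hA : 0 < A) (h : C ^ 2 < A * B) (a b : E) :
    0 ≤ A * inner ℝ a a + B * inner ℝ b b - C * (inner ℝ a b + inner ℝ b a) := by
  rw [quad_eq hA]
  have h1 := sub_pos.2 h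
  have h2 : 0 ≤ inner ℝ b b := real_inner_self_nonneg
  have h3 : 0 ≤ inner ℝ (A • a - C • b) (A • a - C • b) := real_inner_self_nonneg
  positivity

lemma quad_eq_zero {E : Type*} [NormedAddCommGroup E] [InnerProductSpace ℝ E] {A B C : ℝ}
    (hA : 0 < A) (h : C ^ 2 < A * B) {a b : E}
    (h0 : A * inner ℝ a a + B * inner ℝ b b - C * (inner ℝ a b + inner ℝ b a) = 0) :
    a = 0 ∧ b = 0 := by
  rw [quad_eq hA] at h0
  have h1 := sub_pos.2 h
  have h2 : 0 ≤ inner ℝ b b := real_inner_self_nonneg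
  have h3 : 0 ≤ inner ℝ (A • a - C • b) (A • a - C • b) := real_inner_self_nonneg
  have h4 := (mul_eq_zero.1 h0).resolve_left (inv_ne_zero hA.ne')
  have h5 : (A * B - C ^ 2) * inner ℝ b b = 0 := by nlinarith [mul_nonneg h1.le h2]
  have hb : b = 0 := inner_self_eq_zero.1 ((mul_eq_zero.1 h5).resolve_left h1.ne')
  subst hb
  have h6 : A • a - C • (0 : E) = 0 := by
    rw [h5, add_zero] at h4
    exact inner_self_eq_zero.1 h4
  rw [smul_zero, sub_zero] at h6
  exact ⟨(smul_eq_zero.1 h6).resolve_left hA.ne', rfl⟩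

lemma energyInner_self (x : StateSpace p) : energyInner x x
    = (p.CA * inner ℝ (wd x.x1) (wd x.x1) + p.CI * inner ℝ (wd x.x2) (wd x.x2)
        - p.CI0 * (inner ℝ (wd x.x1) (wd x.x2) + inner ℝ (wd x.x2) (wd x.x1)))
      + 1 / 2 * p.GA * inner ℝ (wd x.x3 - x.x2) (wd x.x3 - x.x2)
      + 1 / p.μ * p.Ap * inner ℝ (wd x.x4) (wd x.x4)
      + (p.ρA * inner ℝ x.x5 x.x5 + p.ρI * inner ℝ x.x6 x.x6
        - p.ρI0 * (inner ℝ x.x5 x.x6 + inner ℝ x.x6 x.x5))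
      + p.ρA * inner ℝ x.x7 x.x7 + p.ε * p.Ap * inner ℝ x.x8 x.x8 := by
  rw [energyInner, inner_sub_left, inner_sub_right, inner_sub_right]
  ring

/-- The energy inner product is an inner product. -/
@[reducible]
def energyCore (p : BeamParams) : InnerProductSpace.Core ℝ (StateSpace p) where
  inner := energyInner
  conj_inner_symm x y := by
    simp only [conj_trivial, energyInner]
    simp only [real_inner_comm (wd x.x1), real_inner_comm (wd x.x2), real_inner_comm (wd x.x3),
      real_inner_comm (wd x.x4), real_inner_comm x.x2, real_inner_comm x.x5, real_inner_comm x.x6,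
      real_inner_comm x.x7, real_inner_comm x.x8]
    ring
  re_inner_nonneg x := by
    rw [RCLike.re_to_real]
    rw [energyInner_self]
    have h1 := quad_nonneg p.CA_pos p.CI0_sq_lt (wd x.x1) (wd x.x2)
    have h2 := quad_nonneg p.ρA_pos p.ρI0_sq_lt x.x5 x.x6
    have := p.GA_pos
    have := p.Ap_pos
    have := p.μ_pos
    have := p.ε_pos
    have := p.ρA_pos
    have i1 : 0 ≤ inner ℝ (wd x.x3 - x.x2) (wd x.x3 - x.x2) := real_inner_self_nonneg
    have i2 : 0 ≤ inner ℝ (wd x.x4) (wd x.x4) := real_inner_self_nonneg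
    have i3 : 0 ≤ inner ℝ x.x7 x.x7 := real_inner_self_nonneg
    have i4 : 0 ≤ inner ℝ x.x8 x.x8 := real_inner_self_nonneg
    positivity
  add_left x y z := by
    simp only [energyInner, x1_add, x2_add, x3_add, x4_add, x5_add, x6_add, x7_add, x8_add,
      wd_add x.x1_mem.1 y.x1_mem.1, wd_add x.x2_mem.1 y.x2_mem.1, wd_add x.x3_mem.1 y.x3_mem.1,
      wd_add x.x4_mem.1 y.x4_mem.1, inner_add_left]
    ring
  smul_left x y c := by
    simp only [energyInner, x1_smul, x2_smul, x3_smul, x4_smul, x5_smul, x6_smul, x7_smul, x8_smul,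
      wd_smul x.x1_mem.1, wd_smul x.x2_mem.1, wd_smul x.x3_mem.1, wd_smul x.x4_mem.1,
      real_inner_smul_left, conj_trivial]
    ring
  definite x h := by
    change energyInner x x = 0 at h
    rw [energyInner_self] at h
    have h1 := quad_nonneg p.CA_pos p.CI0_sq_lt (wd x.x1) (wd x.x2)
    have h2 := quad_nonneg p.ρA_pos p.ρI0_sq_lt x.x5 x.x6
    have q1 : 0 < 1 / 2 * p.GA := mul_pos (by norm_num) p.GA_pos
    have q2 : 0 < 1 / p.μ * p.Ap := mul_pos (one_div_pos.2 p.μ_pos) p.Ap_pos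
    have q3 := p.ρA_pos
    have q4 : 0 < p.ε * p.Ap := mul_pos p.ε_pos p.Ap_pos
    have i1 := mul_nonneg q1.le (real_inner_self_nonneg (x := wd x.x3 - x.x2))
    have i2 := mul_nonneg q2.le (real_inner_self_nonneg (x := wd x.x4))
    have i3 := mul_nonneg q3.le (real_inner_self_nonneg (x := x.x7))
    have i4 := mul_nonneg q4.le (real_inner_self_nonneg (x := x.x8))
    have aux : ∀ {c : ℝ} {u : L2}, 0 < c → c * inner ℝ u u = 0 → u = 0 := fun hc hu =>
      inner_self_eq_zero.1 ((mul_eq_zero.1 hu).resolve_left hc.ne')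
    obtain ⟨z1, z2⟩ := quad_eq_zero p.CA_pos p.CI0_sq_lt (a := wd x.x1) (b := wd x.x2) (by linarith)
    obtain ⟨z5, z6⟩ := quad_eq_zero p.ρA_pos p.ρI0_sq_lt (a := x.x5) (b := x.x6) (by linarith)
    have z3 : wd x.x3 - x.x2 = 0 := aux q1 (by linarith)
    have z4 : wd x.x4 = 0 := aux q2 (by linarith)
    have z7 : x.x7 = 0 := aux q3 (by linarith)
    have z8 : x.x8 = 0 := aux q4 (by linarith)
    have y2 := eq_zero_of_wd_eq_zero x.x2_mem z2
    rw [y2, sub_zero] at z3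
    exact ext_comp (eq_zero_of_wd_eq_zero x.x1_mem z1) y2 (eq_zero_of_wd_eq_zero x.x3_mem z3)
      (eq_zero_of_wd_eq_zero x.x4_mem z4) z5 z6 z7 z8

/-- The norm of the state space is induced by the energy inner product. -/
instance : NormedAddCommGroup (StateSpace p) := (energyCore p).toNormedAddCommGroup
instance : InnerProductSpace ℝ (StateSpace p) := InnerProductSpace.ofCore (energyCore p).toCore

/-- The squared norm is the energy inner product, that is twice the Hamiltonian. -/
lemma norm_sq_eq (x : StateSpace p) : ‖x‖ ^ 2 = energyInner x x :=
  (real_inner_self_eq_norm_sq x).symm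

lemma inner_eq (x y : StateSpace p) : inner ℝ x y = energyInner x y := rfl

end StateSpace

open StateSpace

/-- The domain of the Timoshenko operator: `x₁, …, x₄ ∈ H²(0,1) ∩ H¹₀(0,1)`, `x₅, …, x₈ ∈ H¹₀(0,1)`
and the four natural boundary conditions at `z = 1`. -/
def domAT (p : BeamParams) : Submodule ℝ (StateSpace p) where
  carrier := {x |
    (wd x.x1 ∈ H1 ∧ wd x.x2 ∈ H1 ∧ wd x.x3 ∈ H1 ∧ wd x.x4 ∈ H1) ∧
    (x.x5 ∈ H10 ∧ x.x6 ∈ H10 ∧ x.x7 ∈ H10 ∧ x.x8 ∈ H10) ∧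
    p.CA * trace (wd x.x1) 1 - p.CI0 * trace (wd x.x2) 1 - p.γ * p.Ap * trace x.x8 1 = 0 ∧
    p.CI * trace (wd x.x2) 1 - p.CI0 * trace (wd x.x1) 1 + p.γ * p.I0p * trace x.x8 1 = 0 ∧
    p.GA / 2 * (trace (wd x.x3) 1 - trace x.x2 1) = 0 ∧
    1 / p.μ * p.Ap * trace (wd x.x4) 1 = 0}
  add_mem' := by
    rintro x y ⟨⟨a1, a2, a3, a4⟩, ⟨a5, a6, a7, a8⟩, a9, a10, a11, a12⟩
      ⟨⟨b1, b2, b3, b4⟩, ⟨b5, b6, b7, b8⟩, b9, b10, b11, b12⟩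
    have e : (1 : ℝ) ∈ Icc (0 : ℝ) 1 := by simp
    simp only [mem_ofPred_eq, x1_add, x2_add, x3_add, x4_add, x5_add, x6_add, x7_add, x8_add,
      wd_add x.x1_mem.1 y.x1_mem.1, wd_add x.x2_mem.1 y.x2_mem.1, wd_add x.x3_mem.1 y.x3_mem.1,
      wd_add x.x4_mem.1 y.x4_mem.1, trace_add a1 b1 e, trace_add a2 b2 e, trace_add a3 b3 e,
      trace_add a4 b4 e, trace_add a8.1 b8.1 e, trace_add x.x2_mem.1 y.x2_mem.1 e]
    exact ⟨⟨H1.add_mem a1 b1, H1.add_mem a2 b2, H1.add_mem a3 b3, H1.add_mem a4 b4⟩,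
      ⟨H10.add_mem a5 b5, H10.add_mem a6 b6, H10.add_mem a7 b7, H10.add_mem a8 b8⟩,
      by linear_combination a9 + b9, by linear_combination a10 + b10,
      by linear_combination a11 + b11, by linear_combination a12 + b12⟩
  zero_mem' := by
    have e : (1 : ℝ) ∈ Icc (0 : ℝ) 1 := by simp
    have h1 : (0 : StateSpace p).x1 = 0 := rfl
    have h2 : (0 : StateSpace p).x2 = 0 := rfl
    have h3 : (0 : StateSpace p).x3 = 0 := rfl
    have h4 : (0 : StateSpace p).x4 = 0 := rfl
    have h5 : (0 : StateSpace p).x5 = 0 := rfl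
    have h6 : (0 : StateSpace p).x6 = 0 := rfl
    have h7 : (0 : StateSpace p).x7 = 0 := rfl
    have h8 : (0 : StateSpace p).x8 = 0 := rfl
    simp only [mem_ofPred_eq, h1, h2, h3, h4, h5, h6, h7, h8, wd_zero, trace_zero e, H1.zero_mem,
      H10.zero_mem, mul_zero, sub_zero, add_zero, and_self]
  smul_mem' := by
    rintro c x ⟨⟨a1, a2, a3, a4⟩, ⟨a5, a6, a7, a8⟩, a9, a10, a11, a12⟩
    have e : (1 : ℝ) ∈ Icc (0 : ℝ) 1 := by simp
    simp only [mem_ofPred_eq, x1_smul, x2_smul, x3_smul, x4_smul, x5_smul, x6_smul, x7_smul, x8_smul,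
      wd_smul x.x1_mem.1, wd_smul x.x2_mem.1, wd_smul x.x3_mem.1, wd_smul x.x4_mem.1,
      trace_smul a1 c e, trace_smul a2 c e, trace_smul a3 c e, trace_smul a4 c e,
      trace_smul a8.1 c e, trace_smul x.x2_mem.1 c e]
    exact ⟨⟨H1.smul_mem c a1, H1.smul_mem c a2, H1.smul_mem c a3, H1.smul_mem c a4⟩,
      ⟨H10.smul_mem c a5, H10.smul_mem c a6, H10.smul_mem c a7, H10.smul_mem c a8⟩,
      by linear_combination c * a9, by linear_combination c * a10,
      by linear_combination c * a11, by linear_combination c * a12⟩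

/-- The Timoshenko operator `A_T : Dom(A_T) ⊂ X_T → X_T`. -/
def AT (p : BeamParams) : StateSpace p →ₗ.[ℝ] StateSpace p where
  domain := domAT p
  toFun :=
    { toFun := fun x =>
        (![⟨x.1.x5, x.2.2.1.1⟩, ⟨x.1.x6, x.2.2.1.2.1⟩, ⟨x.1.x7, x.2.2.1.2.2.1⟩,
            ⟨x.1.x8, x.2.2.1.2.2.2⟩],
          ![p.a51 • wd (wd x.1.x1) - p.a52 • wd (wd x.1.x2) - p.a53 • x.1.x2
              + p.a53 • wd x.1.x3 - p.a58 • wd x.1.x8,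
            - p.a61 • wd (wd x.1.x1) + p.a62 • wd (wd x.1.x2) - p.a63 • x.1.x2
              + p.a63 • wd x.1.x3 + p.a68 • wd x.1.x8,
            - p.a7 • wd x.1.x2 + p.a7 • wd (wd x.1.x3),
            p.a84 • wd (wd x.1.x4) - p.a85 • wd x.1.x5 + p.a86 • wd x.1.x6])
      map_add' := by
        rintro ⟨x, ⟨a1, a2, a3, a4⟩, ⟨a5, a6, a7, a8⟩, -⟩ ⟨y, ⟨b1, b2, b3, b4⟩, ⟨b5, b6, b7, b8⟩, -⟩
        have e1 : wd (x + y).x1 = wd x.x1 + wd y.x1 := wd_add x.x1_mem.1 y.x1_mem.1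
        have e2 : wd (x + y).x2 = wd x.x2 + wd y.x2 := wd_add x.x2_mem.1 y.x2_mem.1
        have e3 : wd (x + y).x3 = wd x.x3 + wd y.x3 := wd_add x.x3_mem.1 y.x3_mem.1
        have e4 : wd (x + y).x4 = wd x.x4 + wd y.x4 := wd_add x.x4_mem.1 y.x4_mem.1
        have e5 : wd (x + y).x5 = wd x.x5 + wd y.x5 := wd_add a5.1 b5.1
        have e6 : wd (x + y).x6 = wd x.x6 + wd y.x6 := wd_add a6.1 b6.1
        have e8 : wd (x + y).x8 = wd x.x8 + wd y.x8 := wd_add a8.1 b8.1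
        refine ext_comp rfl rfl rfl rfl ?_ ?_ ?_ ?_
        · change p.a51 • wd (wd (x + y).x1) - p.a52 • wd (wd (x + y).x2) - p.a53 • (x + y).x2
              + p.a53 • wd (x + y).x3 - p.a58 • wd (x + y).x8
            = (p.a51 • wd (wd x.x1) - p.a52 • wd (wd x.x2) - p.a53 • x.x2
              + p.a53 • wd x.x3 - p.a58 • wd x.x8)
              + (p.a51 • wd (wd y.x1) - p.a52 • wd (wd y.x2) - p.a53 • y.x2
              + p.a53 • wd y.x3 - p.a58 • wd y.x8)
          rw [e1, e2, e3, e8, wd_add a1 b1, wd_add a2 b2, x2_add]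
          module
        · change - p.a61 • wd (wd (x + y).x1) + p.a62 • wd (wd (x + y).x2) - p.a63 • (x + y).x2
              + p.a63 • wd (x + y).x3 + p.a68 • wd (x + y).x8
            = (- p.a61 • wd (wd x.x1) + p.a62 • wd (wd x.x2) - p.a63 • x.x2
              + p.a63 • wd x.x3 + p.a68 • wd x.x8)
              + (- p.a61 • wd (wd y.x1) + p.a62 • wd (wd y.x2) - p.a63 • y.x2
              + p.a63 • wd y.x3 + p.a68 • wd y.x8)
          rw [e1, e2, e3, e8, wd_add a1 b1, wd_add a2 b2, x2_add]
          module
        · change - p.a7 • wd (x + y).x2 + p.a7 • wd (wd (x + y).x3)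
            = (- p.a7 • wd x.x2 + p.a7 • wd (wd x.x3)) + (- p.a7 • wd y.x2 + p.a7 • wd (wd y.x3))
          rw [e2, e3, wd_add a3 b3]
          module
        · change p.a84 • wd (wd (x + y).x4) - p.a85 • wd (x + y).x5 + p.a86 • wd (x + y).x6
            = (p.a84 • wd (wd x.x4) - p.a85 • wd x.x5 + p.a86 • wd x.x6)
              + (p.a84 • wd (wd y.x4) - p.a85 • wd y.x5 + p.a86 • wd y.x6)
          rw [e4, e5, e6, wd_add a4 b4]
          module
      map_smul' := by
        rintro c ⟨x, ⟨a1, a2, a3, a4⟩, ⟨a5, a6, a7, a8⟩, -⟩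
        have e1 : wd (c • x).x1 = c • wd x.x1 := wd_smul x.x1_mem.1 c
        have e2 : wd (c • x).x2 = c • wd x.x2 := wd_smul x.x2_mem.1 c
        have e3 : wd (c • x).x3 = c • wd x.x3 := wd_smul x.x3_mem.1 c
        have e4 : wd (c • x).x4 = c • wd x.x4 := wd_smul x.x4_mem.1 c
        have e5 : wd (c • x).x5 = c • wd x.x5 := wd_smul a5.1 c
        have e6 : wd (c • x).x6 = c • wd x.x6 := wd_smul a6.1 c
        have e8 : wd (c • x).x8 = c • wd x.x8 := wd_smul a8.1 c
        refine ext_comp rfl rfl rfl rfl ?_ ?_ ?_ ?_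
        · change p.a51 • wd (wd (c • x).x1) - p.a52 • wd (wd (c • x).x2) - p.a53 • (c • x).x2
              + p.a53 • wd (c • x).x3 - p.a58 • wd (c • x).x8
            = c • (p.a51 • wd (wd x.x1) - p.a52 • wd (wd x.x2) - p.a53 • x.x2
              + p.a53 • wd x.x3 - p.a58 • wd x.x8)
          rw [e1, e2, e3, e8, wd_smul a1, wd_smul a2, x2_smul]
          module
        · change - p.a61 • wd (wd (c • x).x1) + p.a62 • wd (wd (c • x).x2) - p.a63 • (c • x).x2
              + p.a63 • wd (c • x).x3 + p.a68 • wd (c • x).x8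
            = c • (- p.a61 • wd (wd x.x1) + p.a62 • wd (wd x.x2) - p.a63 • x.x2
              + p.a63 • wd x.x3 + p.a68 • wd x.x8)
          rw [e1, e2, e3, e8, wd_smul a1, wd_smul a2, x2_smul]
          module
        · change - p.a7 • wd (c • x).x2 + p.a7 • wd (wd (c • x).x3)
            = c • (- p.a7 • wd x.x2 + p.a7 • wd (wd x.x3))
          rw [e2, e3, wd_smul a3]
          module
        · change p.a84 • wd (wd (c • x).x4) - p.a85 • wd (c • x).x5 + p.a86 • wd (c • x).x6
            = c • (p.a84 • wd (wd x.x4) - p.a85 • wd x.x5 + p.a86 • wd x.x6)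
          rw [e4, e5, e6, wd_smul a4]
          module }

/-- `T` is a strongly continuous semigroup of bounded linear operators on `X`. -/
structure IsC0Semigroup {X : Type*} [NormedAddCommGroup X] [NormedSpace ℝ X]
    (T : ℝ≥0 → X →L[ℝ] X) : Prop where
  map_zero : T 0 = ContinuousLinearMap.id ℝ X
  map_add : ∀ s t, T (s + t) = (T s).comp (T t)
  tendsto_zero : ∀ x, Tendsto (fun t => T t x) (𝓝 0) (𝓝 x)

/-- The (possibly unbounded) operator `A` is the infinitesimal generator of `T`: `x ∈ Dom(A)` and
`A x = y` if and only if `(T(t) x - x) / t → y` as `t → 0+`. -/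
def IsGenerator {X : Type*} [NormedAddCommGroup X] [NormedSpace ℝ X]
    (A : X →ₗ.[ℝ] X) (T : ℝ≥0 → X →L[ℝ] X) : Prop :=
  ∀ x y : X, (∃ hx : x ∈ A.domain, A ⟨x, hx⟩ = y) ↔
    Tendsto (fun t : ℝ≥0 => (t : ℝ)⁻¹ • (T t x - x)) (𝓝[>] 0) (𝓝 y)

end PiezoBeam

end

noncomputable section

open MeasureTheory Set Filter Topology
open scoped ContDiff NNReal

/-! In the energy inner product `AT p` is skew-symmetric and maps its domain onto the whole space,
and on a real Hilbert space these two facts suffice (`exists_semigroup_of_skew`). Polarisation and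
surjectivity give injectivity; the inverse is an everywhere defined skew operator, hence bounded by
the closed graph theorem. Its skewness makes the domain dense and reduces `l x - A x = f` to
inverting the coercive operator `1 - l A⁻¹`. The Lumer–Phillips theorem, proved through Yosida
approximations, then applies.

Skew-symmetry (`inner_AT_self`) is conservation of energy. The mass matrix turns the last four
components of the operator into balance laws; paired with the velocities and integrated by parts,
their interior terms cancel, and the boundary terms vanish at `0` by the clamping and at `1` by the
natural conditions. Surjectivity (`AT_surjective`) is the static problem, solved by integrating
twice: stresses from the free end, displacements from the clamped end, with the inversion of a
positive definite stiffness matrix in between. Completeness holds because completing the squares in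
the energy identifies the state space isometrically with `L²(0,1)⁸` (`energyCoord`), differentiation
being onto from `H10` to `L2`. -/

namespace PiezoBeam

/-! ### Semigroups of bounded dissipative operators -/

section LumerPhillips

variable {X : Type*} [NormedAddCommGroup X] [InnerProductSpace ℝ X]

/-- Equibounded operators that tend to zero on a dense set tend to zero everywhere. -/
lemma tendsto_zero_of_dense {ι : Type*} {l : Filter ι} {S : ι → X →L[ℝ] X} {C : ℝ} (hC : 0 < C)
    (hS : ∀ i x, ‖S i x‖ ≤ C * ‖x‖) {D : Set X} (hD : Dense D)
    (h : ∀ x ∈ D, Tendsto (fun i => S i x) l (𝓝 0)) (x : X) :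
    Tendsto (fun i => S i x) l (𝓝 0) := by
  rw [Metric.tendsto_nhds]
  intro e he
  obtain ⟨y, hy, hxy⟩ := hD.exists_dist_lt x (ε := e / (2 * C)) (by positivity)
  filter_upwards [Metric.tendsto_nhds.1 (h y hy) (e / 2) (by positivity)] with i hi
  rw [dist_zero_right] at hi ⊢
  rw [dist_eq_norm, lt_div_iff₀ (by positivity)] at hxy
  have h1 : S i x = S i (x - y) + S i y := by rw [map_sub]; abel
  rw [h1]
  have h2 := norm_add_le (S i (x - y)) (S i y)
  have h3 := hS i (x - y)
  nlinarith

section Exp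

variable [CompleteSpace X]

lemma hasDerivAt_exp_smul_apply (A : X →L[ℝ] X) (x : X) (t : ℝ) :
    HasDerivAt (fun s : ℝ => NormedSpace.exp (s • A) x) (NormedSpace.exp (t • A) (A x)) t := by
  have h := (hasDerivAt_exp_smul_const (𝕂 := ℝ) A t).clm_apply (hasDerivAt_const t x)
  simpa using h

/-- With the generator outside, the derivative of the squared norm is `2⟪u, A u⟫`, where
dissipativity applies. The form with the generator inside serves estimates in which contractions act
on `A x`. -/
lemma hasDerivAt_exp_smul_apply' (A : X →L[ℝ] X) (x : X) (t : ℝ) :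
    HasDerivAt (fun s : ℝ => NormedSpace.exp (s • A) x) (A (NormedSpace.exp (t • A) x)) t := by
  have h := (hasDerivAt_exp_smul_const' (𝕂 := ℝ) A t).clm_apply (hasDerivAt_const t x)
  simpa using h

/-- A bounded dissipative operator generates contractions. -/
lemma norm_exp_smul_apply_le {A : X →L[ℝ] X} (hA : ∀ x, inner ℝ (A x) x ≤ 0) {t : ℝ} (ht : 0 ≤ t)
    (x : X) : ‖NormedSpace.exp (t • A) x‖ ≤ ‖x‖ := by
  have hd := fun s : ℝ => (hasDerivAt_exp_smul_apply' A x s).norm_sq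
  have hanti : Antitone fun s : ℝ => ‖NormedSpace.exp (s • A) x‖ ^ 2 := by
    apply antitone_of_deriv_nonpos (fun s => (hd s).differentiableAt)
    intro s
    rw [(hd s).deriv, real_inner_comm]
    linarith [hA (NormedSpace.exp (s • A) x)]
  have h := hanti ht
  simp only [zero_smul, NormedSpace.exp_zero, one_apply_eq_self] at h
  exact le_of_sq_le_sq h (norm_nonneg _)

lemma exp_add_of_commute {A B : X →L[ℝ] X} (h : Commute A B) :
    NormedSpace.exp (A + B) = NormedSpace.exp A * NormedSpace.exp B :=
  letI : NormedAlgebra ℚ (X →L[ℝ] X) := NormedAlgebra.restrictScalars ℚ ℝ _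
  NormedSpace.exp_add_of_commute h

lemma exp_add_smul_apply (A : X →L[ℝ] X) (s t : ℝ) (x : X) :
    NormedSpace.exp ((s + t) • A) x = NormedSpace.exp (s • A) (NormedSpace.exp (t • A) x) := by
  rw [add_smul, exp_add_of_commute ((Commute.refl A).smul_left s |>.smul_right t)]
  rfl

/-- Comparison of the semigroups generated by two commuting bounded dissipative operators. -/
lemma norm_exp_sub_exp_le {A B : X →L[ℝ] X} (hA : ∀ x, inner ℝ (A x) x ≤ 0)
    (hB : ∀ x, inner ℝ (B x) x ≤ 0) (hAB : Commute A B) {t : ℝ} (ht : 0 ≤ t) (x : X) :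
    ‖NormedSpace.exp (t • A) x - NormedSpace.exp (t • B) x‖ ≤ t * ‖A x - B x‖ := by
  -- The difference is the increment over `[0, t]` of `s ↦ exp (s(A - B)) exp (tB) x`. Since `A - B`
  -- need not be dissipative, the exponentials are regrouped as `exp (sA) exp ((t - s)B)`, a product
  -- of contractions for `0 ≤ s ≤ t`; the derivative is this product applied to `(A - B) x`.
  have hexp : ∀ s : ℝ, NormedSpace.exp (s • (A - B)) * NormedSpace.exp (t • B)
      = NormedSpace.exp (s • A) * NormedSpace.exp ((t - s) • B) := by
    intro s
    rw [← exp_add_of_commute, ← exp_add_of_commute]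
    · congr 1; module
    · exact (hAB.smul_left s).smul_right _
    · exact ((hAB.sub_left (Commute.refl B)).smul_left s).smul_right t
  have hc : Commute (A - B) (NormedSpace.exp (t • B)) :=
    ((hAB.sub_left (Commute.refl B)).smul_right t).exp_right
  have hd := fun s : ℝ =>
    hasDerivAt_exp_smul_apply (A - B) (NormedSpace.exp (t • B) x) s
  have hbound : ∀ s ∈ Ico (0 : ℝ) t,
      ‖NormedSpace.exp (s • (A - B)) ((A - B) (NormedSpace.exp (t • B) x))‖ ≤ ‖A x - B x‖ := by
    intro s hs
    have e1 : NormedSpace.exp (s • (A - B)) ((A - B) (NormedSpace.exp (t • B) x))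
        = NormedSpace.exp (s • A) (NormedSpace.exp ((t - s) • B) ((A - B) x)) := by
      have h1 := DFunLike.congr_fun hc.eq x
      have h2 := DFunLike.congr_fun (hexp s) ((A - B) x)
      simp only [mul_apply_eq_comp] at h1 h2
      rw [h1, h2]
    rw [e1]
    exact (norm_exp_smul_apply_le hA hs.1 _).trans
      (norm_exp_smul_apply_le hB (sub_nonneg.2 hs.2.le) _)
  have h := norm_image_sub_le_of_norm_deriv_le_segment' (a := 0) (b := t)
    (fun s _ => (hd s).hasDerivWithinAt) hbound t (right_mem_Icc.2 ht)
  have h2 := DFunLike.congr_fun (hexp t) x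
  simp only [mul_apply_eq_comp, sub_self, zero_smul, NormedSpace.exp_zero,
    one_apply_eq_self] at h2
  simp only [zero_smul, NormedSpace.exp_zero, one_apply_eq_self, h2, sub_zero] at h
  rwa [mul_comm] at h

lemma norm_exp_apply_sub_le {A : X →L[ℝ] X} (hA : ∀ x, inner ℝ (A x) x ≤ 0) {t : ℝ} (ht : 0 ≤ t)
    (x : X) : ‖NormedSpace.exp (t • A) x - x‖ ≤ t * ‖A x‖ := by
  simpa using norm_exp_sub_exp_le (B := 0) hA (by simp) (Commute.zero_right A) ht x

/-- First-order expansion of the exponential, with an explicit remainder. -/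
lemma norm_exp_apply_sub_sub_le {A : X →L[ℝ] X} {t c : ℝ} (ht : 0 ≤ t) (x y : X)
    (h : ∀ s ∈ Ico 0 t, ‖NormedSpace.exp (s • A) (A x) - y‖ ≤ c) :
    ‖NormedSpace.exp (t • A) x - x - t • y‖ ≤ t * c := by
  have hd : ∀ s : ℝ, HasDerivAt (fun s : ℝ => NormedSpace.exp (s • A) x - s • y)
      (NormedSpace.exp (s • A) (A x) - y) s := fun s => by
    have h := (hasDerivAt_exp_smul_apply A x s).sub ((hasDerivAt_id s).smul_const y)
    rw [one_smul] at h
    exact h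
  have h := norm_image_sub_le_of_norm_deriv_le_segment' (a := 0) (b := t)
    (fun s _ => (hd s).hasDerivWithinAt) h t (right_mem_Icc.2 ht)
  simp only [zero_smul, NormedSpace.exp_zero, one_apply_eq_self, sub_zero] at h
  rw [mul_comm, sub_right_comm]
  exact h

end Exp

/-! ### Resolvents of a dissipative operator, described through its graph -/

section Graph

variable {G : Submodule ℝ (X × X)}

/-- The a priori estimate for the resolvent equation of a dissipative operator with graph `G`. -/
lemma norm_le_of_dissipative (hG : ∀ q ∈ G, inner ℝ q.2 q.1 ≤ 0) (l : ℝ) {x y : X}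
    (hxy : (x, y) ∈ G) : l * ‖x‖ ≤ ‖l • x - y‖ := by
  rcases eq_or_ne x 0 with rfl | hx
  · simp
  have h1 : inner ℝ y x ≤ 0 := hG _ hxy
  have h2 : l * ‖x‖ ^ 2 ≤ inner ℝ (l • x - y) x := by
    rw [inner_sub_left, real_inner_smul_left, real_inner_self_eq_norm_sq]; linarith
  have h3 := real_inner_le_norm (l • x - y) x
  have h4 := norm_pos_iff.2 hx
  nlinarith

/-- The resolvent `(l - A)⁻¹` of a dissipative operator `A` with graph `G` and full range. -/
lemma exists_resolvent (hG : ∀ q ∈ G, inner ℝ q.2 q.1 ≤ 0) {l : ℝ} (hl : 0 < l)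
    (hR : ∀ f, ∃ q ∈ G, l • q.1 - q.2 = f) :
    ∃ R : X →L[ℝ] X, (∀ f, (R f, l • R f - f) ∈ G) ∧
      ∀ q ∈ G, R (l • q.1 - q.2) = q.1 := by
  choose q hq hqf using hR
  -- The a priori estimate with right-hand side zero gives uniqueness, so the arbitrarily chosen
  -- solutions depend linearly on the data.
  have huniq : ∀ q' ∈ G, (q (l • q'.1 - q'.2)).1 = q'.1 := by
    intro q' hq'
    have h := norm_le_of_dissipative hG l (x := (q (l • q'.1 - q'.2) - q').1)
      (y := (q (l • q'.1 - q'.2) - q').2) (G.sub_mem (hq _) hq')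
    have e : l • (q (l • q'.1 - q'.2) - q').1 - (q (l • q'.1 - q'.2) - q').2 = 0 := by
      have := hqf (l • q'.1 - q'.2)
      rw [Prod.fst_sub, Prod.snd_sub, smul_sub, sub_sub_sub_comm, this, sub_self]
    rw [e, norm_zero] at h
    have h2 : ‖(q (l • q'.1 - q'.2) - q').1‖ = 0 :=
      le_antisymm (by nlinarith) (norm_nonneg _)
    rw [norm_eq_zero, Prod.fst_sub] at h2
    exact sub_eq_zero.1 h2
  let R₀ : X →ₗ[ℝ] X :=
    { toFun := fun f => (q f).1
      map_add' := fun f g => by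
        have h := huniq _ (G.add_mem (hq f) (hq g))
        have e : l • (q f + q g).1 - (q f + q g).2 = f + g := by
          conv_rhs => rw [← hqf f, ← hqf g]
          rw [Prod.fst_add, Prod.snd_add]; module
        rw [e] at h
        exact h
      map_smul' := fun c f => by
        have h := huniq _ (G.smul_mem c (hq f))
        have e : l • (c • q f).1 - (c • q f).2 = c • f := by
          conv_rhs => rw [← hqf f]
          rw [Prod.smul_fst, Prod.smul_snd]; module
        rw [e] at h
        exact h }
  refine ⟨R₀.mkContinuous l⁻¹ fun f => ?_, fun f => ?_, fun q' hq' => huniq q' hq'⟩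
  · have h := norm_le_of_dissipative hG l (x := (q f).1) (y := (q f).2) (hq f)
    rw [hqf] at h
    change ‖(q f).1‖ ≤ _
    rwa [← div_eq_inv_mul, le_div_iff₀ hl, mul_comm]
  · have e : l • (q f).1 - f = (q f).2 := by
      nth_rewrite 2 [← hqf f]; abel
    change ((q f).1, l • (q f).1 - f) ∈ G
    rw [e]
    exact hq f

/-- With `A` the operator of graph `G`, `(l - A) S f = (l - m) S f + f` and `(l - A) R f = f`.
Subtract and apply `R`. -/
lemma resolvent_identity {l m : ℝ} {R S : X →L[ℝ] X}
    (hR : ∀ f, (R f, l • R f - f) ∈ G) (hS : ∀ f, (S f, m • S f - f) ∈ G)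
    (hR' : ∀ q ∈ G, R (l • q.1 - q.2) = q.1) (f : X) :
    (l - m) • R (S f) = S f - R f := by
  have h := hR' _ (G.sub_mem (hS f) (hR f))
  have e : l • ((S f, m • S f - f) - (R f, l • R f - f)).1
      - ((S f, m • S f - f) - (R f, l • R f - f)).2 = (l - m) • S f := by
    simp only [Prod.mk_sub_mk]; module
  rw [e, map_smul] at h
  exact h

lemma commute_resolvent {l m : ℝ} {R S : X →L[ℝ] X}
    (hR : ∀ f, (R f, l • R f - f) ∈ G) (hS : ∀ f, (S f, m • S f - f) ∈ G)
    (hR' : ∀ q ∈ G, R (l • q.1 - q.2) = q.1) (hS' : ∀ q ∈ G, S (m • q.1 - q.2) = q.1) :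
    Commute R S := by
  ext f
  change R (S f) = S (R f)
  -- For `l = m` the resolvent identity is void, but then both operators invert `l - A` and
  -- coincide. Otherwise the identity and its mirror image agree up to the factor `l - m`.
  rcases eq_or_ne l m with rfl | hlm
  · have : R = S := by
      ext f
      have h := hR' _ (hS f)
      simpa using h
    rw [this]
  · have h1 := resolvent_identity hR hS hR' f
    have h2 := resolvent_identity hS hR hS' f
    have h3 : (l - m) • R (S f) = (l - m) • S (R f) := by
      rw [h1, ← neg_sub m l, neg_smul, h2, neg_sub]
    exact smul_right_injective X (sub_ne_zero.2 hlm) h3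

end Graph
end LumerPhillips

/-! ### Yosida approximation and the generation theorem -/

section LumerPhillips

variable {X : Type*} [NormedAddCommGroup X] [InnerProductSpace ℝ X]

/-- The generator of a contraction semigroup is dissipative. -/
lemma inner_nonpos_of_tendsto_slope {T : ℝ≥0 → X →L[ℝ] X} (hT : ∀ t x, ‖T t x‖ ≤ ‖x‖) {x y : X}
    (h : Tendsto (fun t : ℝ≥0 => (t : ℝ)⁻¹ • (T t x - x)) (𝓝[>] 0) (𝓝 y)) :
    inner ℝ y x ≤ 0 := by
  refine le_of_tendsto (h.inner (tendsto_const_nhds (x := x))) (Eventually.of_forall fun t => ?_)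
  rw [real_inner_smul_left, inner_sub_left, real_inner_self_eq_norm_sq]
  have h1 := real_inner_le_norm (T t x) x
  have h2 := mul_le_mul_of_nonneg_right (hT t x) (norm_nonneg x)
  exact mul_nonpos_of_nonneg_of_nonpos (inv_nonneg.2 t.2) (by nlinarith)

variable {G : Submodule ℝ (X × X)}

/-- A Yosida approximation of a dissipative operator with graph `G`: bounded dissipative operators
`Y n` that commute and converge strongly to the operator. -/
structure IsYosidaApprox (G : Submodule ℝ (X × X)) (Y : ℕ → X →L[ℝ] X) : Prop where
  dissipative : ∀ n x, inner ℝ (Y n x) x ≤ 0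
  commute : ∀ m n, Commute (Y m) (Y n)
  norm_le : ∀ n, ∀ q ∈ G, ‖Y n q.1‖ ≤ ‖q.2‖
  tendsto : ∀ q ∈ G, Tendsto (fun n => Y n q.1) atTop (𝓝 q.2)

/-- With `l = n + 1` and `R = (l - A)⁻¹`, take `Y n = l (l R - 1)`. On the domain this is `l R A`,
and `l R → 1` strongly with `‖l R‖ ≤ 1`. The shift `n + 1` keeps `l` positive from `n = 0` on. -/
lemma exists_yosidaApprox (hG : ∀ q ∈ G, inner ℝ q.2 q.1 ≤ 0)
    (hD : Dense {x | ∃ y, (x, y) ∈ G}) (hR : ∀ l : ℝ, 0 < l → ∀ f, ∃ q ∈ G, l • q.1 - q.2 = f) :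
    ∃ Y : ℕ → X →L[ℝ] X, IsYosidaApprox G Y := by
  have hl : ∀ n : ℕ, (0 : ℝ) < n + 1 := fun n => by positivity
  choose R hR1 hR2 using fun n : ℕ => exists_resolvent hG (hl n) (hR _ (hl n))
  have hRn : ∀ (n : ℕ) f, ‖((n : ℝ) + 1) • R n f‖ ≤ ‖f‖ := by
    intro n f
    have h := norm_le_of_dissipative hG ((n : ℝ) + 1) (hR1 n f)
    rwa [sub_sub_cancel, ← Real.norm_of_nonneg (hl n).le, ← norm_smul] at h
  have hRq : ∀ n : ℕ, ∀ q ∈ G, ((n : ℝ) + 1) • R n q.1 - q.1 = R n q.2 := by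
    intro n q hq
    have h := hR2 n q hq
    rw [map_sub, map_smul] at h
    nth_rewrite 2 [← h]
    abel
  have hsmall : ∀ f, Tendsto (fun n => R n f) atTop (𝓝 0) := by
    intro f
    apply squeeze_zero_norm (a := fun n : ℕ => ‖f‖ * (1 / ((n : ℝ) + 1)))
    · intro n
      have h := hRn n f
      rw [norm_smul, Real.norm_of_nonneg (hl n).le] at h
      rwa [mul_one_div, le_div_iff₀ (hl n), mul_comm]
    · simpa using tendsto_one_div_add_atTop_nhds_zero_nat.const_mul ‖f‖
  -- On the domain `l R x - x = R A x`, which is `O(1/l)`; the uniform bound `2` carries the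
  -- convergence to the closure.
  have hJ : ∀ f, Tendsto (fun n : ℕ => (((n : ℝ) + 1) • R n - 1) f) atTop (𝓝 0) := by
    apply tendsto_zero_of_dense (C := 2) two_pos _ hD
    · rintro x ⟨y, hxy⟩
      exact (hsmall y).congr fun n => (hRq n _ hxy).symm
    · intro n x
      have h := norm_sub_le (((n : ℝ) + 1) • R n x) x
      have h2 := hRn n x
      change ‖((n : ℝ) + 1) • R n x - x‖ ≤ _
      linarith
  refine ⟨fun n => ((n : ℝ) + 1) • (((n : ℝ) + 1) • R n - 1), ?_, ?_, ?_, ?_⟩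
  · intro n f
    have h1 : inner ℝ (((n : ℝ) + 1) • R n f - f) (R n f) ≤ 0 := hG _ (hR1 n f)
    change inner ℝ (((n : ℝ) + 1) • (((n : ℝ) + 1) • R n f - f)) f ≤ 0
    -- Write `f = l R f - (l R f - f)`. Since `l R f - f = A R f`, the first contribution has the
    -- sign of `⟪A R f, R f⟫` and the second is minus a square.
    have h2 : inner ℝ (((n : ℝ) + 1) • R n f - f) f
        = ((n : ℝ) + 1) * inner ℝ (((n : ℝ) + 1) • R n f - f) (R n f)
          - ‖((n : ℝ) + 1) • R n f - f‖ ^ 2 := by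
      rw [← real_inner_self_eq_norm_sq, ← real_inner_smul_right, ← inner_sub_right, sub_sub_cancel]
    rw [real_inner_smul_left, h2]
    have h3 := hl n
    have h4 := mul_nonneg h3.le (neg_nonneg.2 h1)
    have h5 := sq_nonneg ‖((n : ℝ) + 1) • R n f - f‖
    exact mul_nonpos_of_nonneg_of_nonpos h3.le (by linarith)
  · intro m n
    have h := commute_resolvent (hR1 m) (hR1 n) (hR2 m) (hR2 n)
    exact ((((h.smul_left _).smul_right _).sub_left (Commute.one_left _)).sub_right
      (Commute.one_right _)).smul_left _ |>.smul_right _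
  · intro n q hq
    change ‖((n : ℝ) + 1) • (((n : ℝ) + 1) • R n q.1 - q.1)‖ ≤ _
    rw [hRq n q hq]
    exact hRn n q.2
  · intro q hq
    have h := (hJ q.2).add_const q.2
    rw [zero_add] at h
    refine h.congr fun n => ?_
    change ((n : ℝ) + 1) • R n q.2 - q.2 + q.2 = ((n : ℝ) + 1) • (((n : ℝ) + 1) • R n q.1 - q.1)
    rw [hRq n q hq, sub_add_cancel]

variable [CompleteSpace X]

namespace IsYosidaApprox

variable {Y : ℕ → X →L[ℝ] X}

/-- On the domain the sequence is Cauchy because two approximating orbits differ by at most `t ‖Y m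
x - Y n x‖`. Contractivity extends this to every `x` by density. -/
lemma exists_limit (hY : IsYosidaApprox G Y)
    (hD : Dense {x | ∃ y, (x, y) ∈ G}) (t : ℝ≥0) (x : X) :
    ∃ z, Tendsto (fun n => NormedSpace.exp ((t : ℝ) • Y n) x) atTop (𝓝 z) := by
  apply cauchySeq_tendsto_of_complete
  rw [cauchySeq_iff_tendsto_dist_atTop_0]
  have key := tendsto_zero_of_dense (l := atTop) (C := 2) two_pos
    (S := fun q : ℕ × ℕ => NormedSpace.exp ((t : ℝ) • Y q.1) - NormedSpace.exp ((t : ℝ) • Y q.2))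
    ?_ hD ?_ x
  · simpa [dist_eq_norm] using key.norm
  · intro q x
    have h1 := norm_exp_smul_apply_le (hY.dissipative q.1) t.2 x
    have h2 := norm_exp_smul_apply_le (hY.dissipative q.2) t.2 x
    have h3 := norm_sub_le (NormedSpace.exp ((t : ℝ) • Y q.1) x)
      (NormedSpace.exp ((t : ℝ) • Y q.2) x)
    change ‖NormedSpace.exp ((t : ℝ) • Y q.1) x - NormedSpace.exp ((t : ℝ) • Y q.2) x‖ ≤ _
    simp only [NNReal.val_eq_coe] at h1 h2
    linarith
  · rintro x ⟨y, hxy⟩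
    have hc := cauchySeq_iff_tendsto_dist_atTop_0.1 (hY.tendsto _ hxy).cauchySeq
    apply squeeze_zero_norm (a := fun q : ℕ × ℕ => (t : ℝ) * dist (Y q.1 x) (Y q.2 x))
    · intro q
      rw [dist_eq_norm]
      exact norm_exp_sub_exp_le (hY.dissipative _) (hY.dissipative _) (hY.commute _ _) t.2 x
    · simpa using hc.const_mul (t : ℝ)

/-- The approximating semigroups are strongly continuous at `0`, uniformly in `n`. -/
lemma tendsto_exp_sub (hY : IsYosidaApprox G Y)
    (hD : Dense {x | ∃ y, (x, y) ∈ G}) (x : X) :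
    Tendsto (fun q : ℕ × ℝ≥0 => NormedSpace.exp ((q.2 : ℝ) • Y q.1) x - x)
      (⊤ ×ˢ 𝓝 0) (𝓝 0) := by
  refine tendsto_zero_of_dense (C := 2) two_pos
    (S := fun q : ℕ × ℝ≥0 => NormedSpace.exp ((q.2 : ℝ) • Y q.1) - 1) ?_ hD ?_ x
  · intro q x
    have h1 := norm_exp_smul_apply_le (hY.dissipative q.1) q.2.2 x
    have h3 := norm_sub_le (NormedSpace.exp ((q.2 : ℝ) • Y q.1) x) x
    change ‖NormedSpace.exp ((q.2 : ℝ) • Y q.1) x - x‖ ≤ _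
    simp only [NNReal.val_eq_coe] at h1
    linarith
  · rintro x ⟨y, hxy⟩
    apply squeeze_zero_norm (a := fun q : ℕ × ℝ≥0 => (q.2 : ℝ) * ‖y‖)
    · intro q
      exact (norm_exp_apply_sub_le (hY.dissipative _) q.2.2 x).trans
        (mul_le_mul_of_nonneg_left (hY.norm_le _ _ hxy) q.2.2)
    · have h : Tendsto (fun t : ℝ≥0 => (t : ℝ) * ‖y‖) (𝓝 0) (𝓝 (((0 : ℝ≥0) : ℝ) * ‖y‖)) :=
        (NNReal.continuous_coe.tendsto 0).mul_const _
      rw [NNReal.coe_zero, zero_mul] at h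
      exact h.comp tendsto_snd

variable {T : ℝ≥0 → X →L[ℝ] X}

lemma norm_limit_apply_le (hY : IsYosidaApprox G Y)
    (hT : ∀ (t : ℝ≥0) x, Tendsto (fun n => NormedSpace.exp ((t : ℝ) • Y n) x) atTop (𝓝 (T t x)))
    (t : ℝ≥0) (x : X) : ‖T t x‖ ≤ ‖x‖ :=
  le_of_tendsto (hT t x).norm
    (Eventually.of_forall fun n => norm_exp_smul_apply_le (hY.dissipative n) t.2 x)

lemma isC0Semigroup (hY : IsYosidaApprox G Y)
    (hT : ∀ (t : ℝ≥0) x, Tendsto (fun n => NormedSpace.exp ((t : ℝ) • Y n) x) atTop (𝓝 (T t x)))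
    (hD : Dense {x | ∃ y, (x, y) ∈ G}) : IsC0Semigroup T where
  map_zero := by
    ext x
    refine tendsto_nhds_unique (hT 0 x) ?_
    simp
  map_add s t := by
    ext x
    refine tendsto_nhds_unique (hT (s + t) x) ?_
    change Tendsto _ _ (𝓝 (T s (T t x)))
    -- Both the operator and its argument vary with `n`; contractivity allows the argument to be
    -- replaced by its limit `T t x` first.
    have h1 : Tendsto (fun n => NormedSpace.exp ((s : ℝ) • Y n)
        (NormedSpace.exp ((t : ℝ) • Y n) x - T t x)) atTop (𝓝 0) := by
      have h2 := (hT t x).sub_const (T t x)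
      rw [sub_self] at h2
      exact squeeze_zero_norm
        (fun n => norm_exp_smul_apply_le (hY.dissipative n) s.2 _) (by simpa using h2.norm)
    have h3 := h1.add (hT s (T t x))
    rw [zero_add] at h3
    refine h3.congr fun n => ?_
    rw [map_sub, sub_add_cancel, NNReal.coe_add, exp_add_smul_apply]
  tendsto_zero x := by
    rw [Metric.tendsto_nhds]
    intro e he
    have h := (Metric.tendsto_nhds.1 (hY.tendsto_exp_sub hD x) (e / 2) (by positivity))
    -- In the filter `⊤` an eventual property holds everywhere, so `pa` is true for all `n` and `pb`
    -- describes a neighbourhood of `0` independent of `n`.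
    rw [eventually_prod_iff] at h
    obtain ⟨pa, hpa, pb, hpb, hp⟩ := h
    filter_upwards [hpb] with t ht
    rw [eventually_top] at hpa
    have h1 : ‖T t x - x‖ ≤ e / 2 := by
      refine le_of_tendsto ((hT t x).sub_const x).norm (Eventually.of_forall fun n => ?_)
      have := hp (hpa n) ht
      rw [dist_zero_right] at this
      exact this.le
    rw [dist_eq_norm]
    linarith

/-- The derivative of the approximating orbit differs from `y` by `exp (s Y n) (Y n x - y) + (exp (s
Y n) y - y)`. The first term is small for large `n`, uniformly in `s`; the second for small `s`,
uniformly in `n`. Hence the first-order expansion survives the limit in `n`. -/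
lemma tendsto_slope (hY : IsYosidaApprox G Y)
    (hT : ∀ (t : ℝ≥0) x, Tendsto (fun n => NormedSpace.exp ((t : ℝ) • Y n) x) atTop (𝓝 (T t x)))
    (hD : Dense {x | ∃ y, (x, y) ∈ G}) {x y : X} (hxy : (x, y) ∈ G) :
    Tendsto (fun t : ℝ≥0 => (t : ℝ)⁻¹ • (T t x - x)) (𝓝[>] 0) (𝓝 y) := by
  rw [Metric.tendsto_nhds]
  intro e he
  have h := (Metric.tendsto_nhds.1 (hY.tendsto_exp_sub hD y) (e / 4) (by positivity))
  rw [eventually_prod_iff] at h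
  obtain ⟨pa, hpa, pb, hpb, hp⟩ := h
  rw [eventually_top] at hpa
  obtain ⟨d, hd, hpd⟩ := Metric.eventually_nhds_iff.1 hpb
  have hball : ∀ᶠ t : ℝ≥0 in 𝓝[>] 0, (t : ℝ) < d := by
    apply nhdsWithin_le_nhds
    filter_upwards [Metric.ball_mem_nhds (0 : ℝ≥0) hd] with t ht
    simpa [NNReal.dist_eq] using ht
  filter_upwards [hball, self_mem_nhdsWithin] with t ht ht0
  have ht0' : (0 : ℝ) < t := NNReal.coe_pos.2 ht0
  have h1 : ‖T t x - x - (t : ℝ) • y‖ ≤ t * (e / 2) := by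
    refine le_of_tendsto (((hT t x).sub_const x).sub_const _).norm ?_
    filter_upwards [Metric.tendsto_nhds.1 (hY.tendsto _ hxy) (e / 4) (by positivity)] with n hn
    apply norm_exp_apply_sub_sub_le t.2
    intro s hs
    have hsd : dist s.toNNReal 0 < d := by
      rw [NNReal.dist_eq, Real.coe_toNNReal s hs.1, NNReal.coe_zero, sub_zero, abs_of_nonneg hs.1]
      exact hs.2.trans ht
    have h2 := hp (hpa n) (hpd hsd)
    simp only [dist_zero_right, Real.coe_toNNReal s hs.1] at h2
    rw [dist_eq_norm] at hn
    have h3 := norm_exp_smul_apply_le (hY.dissipative n) hs.1 (Y n x - y)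
    have e1 : NormedSpace.exp (s • Y n) (Y n x) - y
        = NormedSpace.exp (s • Y n) (Y n x - y) + (NormedSpace.exp (s • Y n) y - y) := by
      rw [map_sub]; abel
    rw [e1]
    refine (norm_add_le _ _).trans ?_
    linarith
  rw [dist_eq_norm]
  have e2 : (t : ℝ)⁻¹ • (T t x - x) - y = (t : ℝ)⁻¹ • (T t x - x - (t : ℝ) • y) := by
    rw [smul_sub _ _ ((t : ℝ) • y), inv_smul_smul₀ ht0'.ne']
  rw [e2, norm_smul, norm_inv, Real.norm_of_nonneg ht0'.le, ← div_eq_inv_mul,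
    div_lt_iff₀ ht0']
  nlinarith

end IsYosidaApprox

/-- **Lumer–Phillips theorem** on a real Hilbert space: a densely defined dissipative operator `A`
such that `l - A` is surjective for all `l > 0` generates a contraction semigroup. -/
theorem exists_semigroup_of_dissipative (A : X →ₗ.[ℝ] X)
    (hA : ∀ x : A.domain, inner ℝ (A x) (x : X) ≤ 0) (hD : Dense (A.domain : Set X))
    (hR : ∀ l : ℝ, 0 < l → ∀ f, ∃ x : A.domain, l • (x : X) - A x = f) :
    ∃ T : ℝ≥0 → X →L[ℝ] X, IsC0Semigroup T ∧ IsGenerator A T ∧ ∀ t, ‖T t‖ ≤ 1 := by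
  have hmem : ∀ x y, (x, y) ∈ A.graph ↔ ∃ hx : x ∈ A.domain, A ⟨x, hx⟩ = y := by
    intro x y
    rw [LinearPMap.mem_graph_iff]
    exact ⟨by rintro ⟨z, rfl, rfl⟩; exact ⟨z.2, rfl⟩, fun ⟨hx, h⟩ => ⟨⟨x, hx⟩, rfl, h⟩⟩
  have hG : ∀ q ∈ A.graph, inner ℝ q.2 q.1 ≤ 0 := by
    rintro ⟨x, y⟩ hq
    obtain ⟨hx, rfl⟩ := (hmem x y).1 hq
    exact hA ⟨x, hx⟩
  have hD' : Dense {x | ∃ y, (x, y) ∈ A.graph} :=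
    hD.mono fun x hx => ⟨A ⟨x, hx⟩, (hmem _ _).2 ⟨hx, rfl⟩⟩
  have hR' : ∀ l : ℝ, 0 < l → ∀ f, ∃ q ∈ A.graph, l • q.1 - q.2 = f := by
    intro l hl f
    obtain ⟨x, hx⟩ := hR l hl f
    exact ⟨(x, A x), (hmem _ _).2 ⟨x.2, rfl⟩, hx⟩
  obtain ⟨Y, hY⟩ := exists_yosidaApprox hG hD' hR'
  choose S hS using hY.exists_limit hD'
  -- By Banach–Steinhaus the pointwise limit is a bounded operator.
  let T : ℝ≥0 → X →L[ℝ] X := fun t => continuousLinearMapOfTendsto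
    (fun n => NormedSpace.exp ((t : ℝ) • Y n)) (f := S t) (tendsto_pi_nhds.2 (hS t))
  have hT : ∀ (t : ℝ≥0) x, Tendsto (fun n => NormedSpace.exp ((t : ℝ) • Y n) x) atTop (𝓝 (T t x)) := hS
  have hTn := hY.norm_limit_apply_le hT
  refine ⟨T, hY.isC0Semigroup hT hD', fun x y => ?_, fun t =>
    (T t).opNorm_le_bound zero_le_one fun x => by simpa using hTn t x⟩
  rw [← hmem]
  refine ⟨hY.tendsto_slope hT hD', fun h => ?_⟩
  -- The generator cannot properly extend `A`. Solve `u - A u = x - y` in the domain: then `x - u`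
  -- has slope limit `y - v = x - u`, and dissipativity of the generator gives `‖x - u‖² ≤ 0`.
  obtain ⟨⟨u, v⟩, huv, huf⟩ := hR' 1 one_pos (x - y)
  have h1 := (h.sub (hY.tendsto_slope hT hD' huv)).congr
    (f₂ := fun t : ℝ≥0 => (t : ℝ)⁻¹ • (T t (x - u) - (x - u))) fun t => by
      rw [map_sub]; module
  have h2 := inner_nonpos_of_tendsto_slope hTn h1
  simp only [one_smul] at huf
  have h3 : y - v = x - u := by
    rw [← sub_eq_zero, show y - v - (x - u) = u - v - (x - y) by abel, huf, sub_self]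
  rw [h3] at h2
  have h4 : x - u = 0 := inner_self_eq_zero.1 (le_antisymm h2 real_inner_self_nonneg)
  obtain rfl : x = u := sub_eq_zero.1 h4
  obtain rfl : y = v := sub_eq_zero.1 (h3.trans h4)
  exact huv

/-! ### Surjective skew-symmetric operators -/

/-- A bounded operator `1 - B` with `B` dissipative is surjective. -/
lemma exists_sub_apply_eq {B : X →L[ℝ] X} (hB : ∀ x, inner ℝ (B x) x ≤ 0) (f : X) :
    ∃ x, x - B x = f := by
  have hinner : ∀ x, ‖x‖ ^ 2 ≤ inner ℝ ((1 - B) x) x := fun x => by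
    change _ ≤ inner ℝ (x - B x) x
    rw [inner_sub_left, real_inner_self_eq_norm_sq]
    linarith [hB x]
  have hbelow : ∀ x, ‖x‖ ≤ ‖(1 - B) x‖ := fun x => by
    rcases eq_or_ne x 0 with rfl | hx
    · simp
    · have := norm_pos_iff.2 hx
      nlinarith [hinner x, real_inner_le_norm ((1 - B) x) x]
  have hcl : IsClosed ((1 - B).range : Set X) :=
    ((1 - B).antilipschitz_of_bound (K := 1) (by simpa using hbelow)).isClosed_range
      (1 - B).uniformContinuous
  have hc := hcl.completeSpace_coe
  have htop : (1 - B).range = ⊤ := by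
    -- The range is closed, so it equals its double orthogonal complement. A vector `w` orthogonal
    -- to it satisfies `‖w‖² ≤ ⟪(1 - B) w, w⟫ = 0`.
    rw [← (1 - B).range.orthogonal_orthogonal, Submodule.eq_top_iff']
    intro v w hw
    have h0 : inner ℝ ((1 - B) w) w = 0 := hw _ ⟨w, rfl⟩
    have h1 := hinner w
    rw [h0] at h1
    obtain rfl : w = 0 := by simpa using le_antisymm h1 (sq_nonneg _)
    exact inner_zero_left _
  obtain ⟨x, hx⟩ : f ∈ (1 - B).range := htop ▸ Submodule.mem_top
  exact ⟨x, hx⟩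

/-- A surjective skew-symmetric operator on a real Hilbert space generates a contraction
semigroup. -/
theorem exists_semigroup_of_skew (A : X →ₗ.[ℝ] X)
    (hA : ∀ x : A.domain, inner ℝ (A x) (x : X) = 0) (hsurj : ∀ f, ∃ x : A.domain, A x = f) :
    ∃ T : ℝ≥0 → X →L[ℝ] X, IsC0Semigroup T ∧ IsGenerator A T ∧ ∀ t, ‖T t‖ ≤ 1 := by
  have hskew : ∀ x y : A.domain, inner ℝ (A x) (y : X) + inner ℝ (x : X) (A y) = 0 := by
    intro x y
    have h := hA (x + y)
    rw [A.map_add, Submodule.coe_add, inner_add_left, inner_add_right, inner_add_right, hA, hA,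
      real_inner_comm (x : X) (A y)] at h
    linarith
  have hinj : ∀ x : A.domain, A x = 0 → x = 0 := by
    intro x hx
    obtain ⟨y, hy⟩ := hsurj x
    have h := hskew x y
    rw [hx, hy, inner_zero_left, zero_add] at h
    exact Subtype.ext (inner_self_eq_zero.1 h)
  have hinj' : ∀ x y : A.domain, A x = A y → x = y := fun x y h =>
    sub_eq_zero.1 (hinj _ (by rw [A.map_sub, h, sub_self]))
  choose b hb using hsurj
  let B₀ : X →ₗ[ℝ] X :=
    { toFun := fun f => b f
      map_add' := fun f g => by
        rw [hinj' (b (f + g)) (b f + b g) (by rw [A.map_add, hb, hb, hb]), Submodule.coe_add]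
      map_smul' := fun c f => by
        rw [hinj' (b (c • f)) (c • b f) (by rw [A.map_smul, hb, hb]), Submodule.coe_smul,
          RingHom.id_apply] }
  have hB₀ : ∀ f g, inner ℝ (B₀ f) g = - inner ℝ f (B₀ g) := by
    intro f g
    have h := hskew (b f) (b g)
    rw [hb, hb] at h
    change inner ℝ (b f : X) g = - inner ℝ f (b g : X)
    linarith
  -- Hellinger–Toeplitz: skewness moves the inverse onto the test vector, where limits pass through,
  -- so its graph is closed.
  have hcont : Continuous B₀ := by
    refine B₀.continuous_of_seq_closed_graph fun u x y hu hBu => ?_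
    refine ext_inner_right ℝ fun z => ?_
    refine tendsto_nhds_unique (hBu.inner (tendsto_const_nhds (x := z))) ?_
    simp only [Function.comp_apply, hB₀]
    exact (hu.inner tendsto_const_nhds).neg
  let B : X →L[ℝ] X := ⟨B₀, hcont⟩
  have hB : ∀ x, inner ℝ (B x) x = 0 := by
    intro x
    have h := hB₀ x x
    rw [real_inner_comm (B₀ x) x] at h
    change inner ℝ (B₀ x) x = 0
    linarith
  refine exists_semigroup_of_dissipative A (fun x => (hA x).le) ?_ fun l hl f => ?_
  -- If `w` is orthogonal to the domain, which contains the range of the inverse, skewness gives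
  -- `A⁻¹ w = 0`, hence `w = 0`.
  · rw [Submodule.dense_iff_topologicalClosure_eq_top, Submodule.topologicalClosure_eq_top_iff,
      Submodule.eq_bot_iff]
    intro w hw
    have h1 : b w = 0 := by
      refine Subtype.ext (ext_inner_left ℝ fun f => ?_)
      have h2 : inner ℝ (B₀ f) w = 0 := hw _ (b f).2
      rw [hB₀, neg_eq_zero] at h2
      rw [ZeroMemClass.coe_zero, inner_zero_right]
      exact h2
    rw [← hb w, h1, A.map_zero]
  -- For `x = A⁻¹ g` the equation `l x - A x = f` reads `g - l A⁻¹ g = -f`.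
  · obtain ⟨g, hg⟩ := exists_sub_apply_eq (B := l • B) (fun x => by
      change inner ℝ (l • B x) x ≤ 0
      rw [real_inner_smul_left, hB, mul_zero]) (-f)
    refine ⟨b g, ?_⟩
    rw [hb, ← neg_sub, neg_eq_iff_eq_neg]
    exact hg

end LumerPhillips

/-! ### Calculus in `H¹(0,1)`: integration by parts and primitives -/

section Sobolev

lemma HasWeakDeriv.wd {f : L2} (hf : f ∈ H1) : HasWeakDeriv f (wd f) := by
  obtain ⟨g, hg⟩ := hf
  rwa [hg.wd_eq]

lemma H1.isContRep_primitive {f : L2} (hf : f ∈ H1) :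
    IsContRep f fun z => trace f 0 + ∫ t in (0 : ℝ)..z, wd f t := by
  obtain ⟨c, hc⟩ := (HasWeakDeriv.wd hf).ae_eq_primitive
  have h : IsContRep f fun z => c + ∫ t in (0 : ℝ)..z, wd f t :=
    ⟨continuousOn_const.add (continuousOn_primitive _), hc⟩
  have h0 : trace f 0 = c := by simpa using h.trace_eq (z := 0) (by simp)
  rwa [h0]

lemma H1.trace_one {f : L2} (hf : f ∈ H1) :
    trace f 1 = trace f 0 + ∫ t in (0 : ℝ)..1, wd f t :=
  (H1.isContRep_primitive hf).trace_eq (by simp)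

lemma absolutelyContinuousOnInterval_const_add_primitive (c : ℝ) (g : L2) :
    AbsolutelyContinuousOnInterval (fun z => c + ∫ t in (0 : ℝ)..z, g t) 0 1 :=
  (contDiff_const (c := c) (n := 1)).contDiffOn.absolutelyContinuousOnInterval.fun_add
    ((intervalIntegrable_coe g).absolutelyContinuousOnInterval_intervalIntegral (c := 0) (by simp))

lemma ae_deriv_const_add_primitive (c : ℝ) (g : L2) :
    ∀ᵐ z, z ∈ uIoc (0 : ℝ) 1 → deriv (fun z => c + ∫ t in (0 : ℝ)..z, g t) z = g z := by
  filter_upwards [(intervalIntegrable_coe g).ae_hasDerivAt_integral] with z hz hz'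
  exact ((hz (uIoc_subset_uIcc hz') 0 (by simp)).const_add c).deriv

lemma inner_eq_intervalIntegral {f g : L2} {F G : ℝ → ℝ}
    (hF : f =ᵐ[volume.restrict (Ioo (0 : ℝ) 1)] F) (hG : g =ᵐ[volume.restrict (Ioo (0 : ℝ) 1)] G) :
    inner ℝ f g = ∫ z in (0 : ℝ)..1, F z * G z := by
  rw [intervalIntegral.integral_of_le zero_le_one, integral_Ioc_eq_integral_Ioo, L2.inner_def]
  apply integral_congr_ae
  filter_upwards [hF, hG] with z h1 h2
  simp [h1, h2, mul_comm]

/-- Integration by parts in `H¹(0,1)`. -/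
lemma inner_wd_add_inner_wd {f g : L2} (hf : f ∈ H1) (hg : g ∈ H1) :
    inner ℝ f (wd g) + inner ℝ (wd f) g = trace f 1 * trace g 1 - trace f 0 * trace g 0 := by
  have h := (absolutelyContinuousOnInterval_const_add_primitive (trace f 0)
    (wd f)).integral_mul_deriv_eq_deriv_mul
    (absolutelyContinuousOnInterval_const_add_primitive (trace g 0) (wd g))
  have e1 : ∫ z in (0 : ℝ)..1, (trace f 0 + ∫ t in (0 : ℝ)..z, wd f t)
      * deriv (fun z => trace g 0 + ∫ t in (0 : ℝ)..z, wd g t) z = inner ℝ f (wd g) := by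
    rw [inner_eq_intervalIntegral (H1.isContRep_primitive hf).2 EventuallyEq.rfl]
    apply intervalIntegral.integral_congr_ae
    filter_upwards [ae_deriv_const_add_primitive (trace g 0) (wd g)] with z hz hz'
    rw [hz hz']
  have e2 : ∫ z in (0 : ℝ)..1, deriv (fun z => trace f 0 + ∫ t in (0 : ℝ)..z, wd f t) z
      * (trace g 0 + ∫ t in (0 : ℝ)..z, wd g t) = inner ℝ (wd f) g := by
    rw [inner_eq_intervalIntegral EventuallyEq.rfl (H1.isContRep_primitive hg).2]
    apply intervalIntegral.integral_congr_ae
    filter_upwards [ae_deriv_const_add_primitive (trace f 0) (wd f)] with z hz hz'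
    rw [hz hz']
  rw [e1, e2, ← H1.trace_one hf, ← H1.trace_one hg] at h
  simp only [intervalIntegral.integral_same, add_zero] at h
  linarith

/-- The primitive `c + ∫₀ᶻ g` is bounded, hence in `L²`. Test functions vanish at both ends, so
integrating by parts leaves no boundary term whatever `c` is. -/
lemma exists_wd_eq_trace_zero (g : L2) (c : ℝ) : ∃ f ∈ H1, wd f = g ∧ trace f 0 = c := by
  let F : ℝ → ℝ := fun z => c + ∫ t in (0 : ℝ)..z, g t
  have hF : ContinuousOn F (Icc 0 1) := continuousOn_const.add (continuousOn_primitive g)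
  have hmem : MemLp F 2 (volume.restrict (Ioo (0 : ℝ) 1)) := by
    obtain ⟨C, hC⟩ := isCompact_Icc.exists_bound_of_continuousOn hF
    refine MemLp.of_bound ((hF.mono Ioo_subset_Icc_self).aestronglyMeasurable measurableSet_Ioo) C ?_
    filter_upwards [ae_restrict_mem measurableSet_Ioo] with z hz
    exact hC z (Ioo_subset_Icc_self hz)
  have hrep : IsContRep hmem.toLp F := ⟨hF, hmem.coeFn_toLp⟩
  have hw : HasWeakDeriv hmem.toLp g := by
    intro η h1 h2 h3
    have hac := absolutelyContinuousOnInterval_const_add_primitive c g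
    have hη : AbsolutelyContinuousOnInterval η 0 1 :=
      (h1.of_le (by simp)).contDiffOn.absolutelyContinuousOnInterval
    have h := hac.integral_mul_deriv_eq_deriv_mul hη
    have e0 : η 0 = 0 := image_eq_zero_of_notMem_tsupport fun h => by simpa using h3 h
    have e1 : η 1 = 0 := image_eq_zero_of_notMem_tsupport fun h => by simpa using h3 h
    have e2 : ∫ z in (0 : ℝ)..1, deriv F z * η z = ∫ z in (0 : ℝ)..1, g z * η z := by
      apply intervalIntegral.integral_congr_ae
      filter_upwards [ae_deriv_const_add_primitive c g] with z hz hz'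
      rw [hz hz']
    have e3 : ∫ z in Ioo (0 : ℝ) 1, (hmem.toLp F : L2) z * deriv η z
        = ∫ z in Ioo (0 : ℝ) 1, F z * deriv η z := by
      apply integral_congr_ae
      filter_upwards [hmem.coeFn_toLp] with z hz
      rw [hz]
    rw [e2, e0, e1, mul_zero, mul_zero, sub_zero, zero_sub] at h
    rw [e3, ← integral_Ioc_eq_integral_Ioo, ← integral_Ioc_eq_integral_Ioo,
      ← intervalIntegral.integral_of_le zero_le_one, ← intervalIntegral.integral_of_le zero_le_one]
    exact h
  exact ⟨hmem.toLp, ⟨g, hw⟩, hw.wd_eq, by simpa [F] using hrep.trace_eq (z := 0) (by simp)⟩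

lemma exists_mem_H10_wd_eq (g : L2) : ∃ f ∈ H10, wd f = g :=
  let ⟨f, hf, hg, h0⟩ := exists_wd_eq_trace_zero g 0
  ⟨f, ⟨hf, h0⟩, hg⟩

/-- Integration from the right end; this produces stresses that vanish at the free end. -/
lemma exists_wd_eq_trace_one_eq_zero (g : L2) : ∃ f ∈ H1, wd f = g ∧ trace f 1 = 0 := by
  obtain ⟨f, hf, hg, h0⟩ := exists_wd_eq_trace_zero g (-∫ t in (0 : ℝ)..1, g t)
  exact ⟨f, hf, hg, by rw [H1.trace_one hf, hg, h0, neg_add_cancel]⟩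

lemma wd_sub {f g : L2} (hf : f ∈ H1) (hg : g ∈ H1) : wd (f - g) = wd f - wd g := by
  have h := wd_add hf (H1.smul_mem (-1) hg)
  rwa [wd_smul hg, neg_one_smul, neg_one_smul, ← sub_eq_add_neg, ← sub_eq_add_neg] at h

lemma trace_sub {f g : L2} (hf : f ∈ H1) (hg : g ∈ H1) {z : ℝ} (hz : z ∈ Icc (0 : ℝ) 1) :
    trace (f - g) z = trace f z - trace g z := by
  have h := trace_add hf (H1.smul_mem (-1) hg) hz
  rwa [trace_smul hg _ hz, neg_one_smul, neg_one_mul, ← sub_eq_add_neg, ← sub_eq_add_neg] at h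

end Sobolev

open StateSpace

section Beam

variable {p : BeamParams}

lemma exists_state (p : BeamParams) {f₁ f₂ f₃ f₄ : L2} (h₁ : f₁ ∈ H10) (h₂ : f₂ ∈ H10)
    (h₃ : f₃ ∈ H10) (h₄ : f₄ ∈ H10) (f₅ f₆ f₇ f₈ : L2) :
    ∃ x : StateSpace p, x.x1 = f₁ ∧ x.x2 = f₂ ∧ x.x3 = f₃ ∧ x.x4 = f₄ ∧
      x.x5 = f₅ ∧ x.x6 = f₆ ∧ x.x7 = f₇ ∧ x.x8 = f₈ :=
  ⟨(![⟨f₁, h₁⟩, ⟨f₂, h₂⟩, ⟨f₃, h₃⟩, ⟨f₄, h₄⟩], ![f₅, f₆, f₇, f₈]),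
    rfl, rfl, rfl, rfl, rfl, rfl, rfl, rfl⟩

/-! ### Completeness of the energy norm -/

section Completeness

/-- Coordinates in which the energy norm is the norm of `L²(0,1)⁸`. -/
def energyCoord (p : BeamParams) :
    StateSpace p →ₗ[ℝ] PiLp 2 (fun _ : Fin 8 => L2) where
  toFun x := WithLp.toLp 2
    ![√p.CA⁻¹ • (p.CA • wd x.x1 - p.CI0 • wd x.x2),
      √(p.CA⁻¹ * (p.CA * p.CI - p.CI0 ^ 2)) • wd x.x2,
      √(1 / 2 * p.GA) • (wd x.x3 - x.x2),
      √(1 / p.μ * p.Ap) • wd x.x4,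
      √p.ρA⁻¹ • (p.ρA • x.x5 - p.ρI0 • x.x6),
      √(p.ρA⁻¹ * (p.ρA * p.ρI - p.ρI0 ^ 2)) • x.x6,
      √p.ρA • x.x7,
      √(p.ε * p.Ap) • x.x8]
  map_add' x y := by
    ext1 i
    fin_cases i <;>
    simp [wd_add x.x1_mem.1 y.x1_mem.1, wd_add x.x2_mem.1 y.x2_mem.1, wd_add x.x3_mem.1 y.x3_mem.1,
      wd_add x.x4_mem.1 y.x4_mem.1] <;> module
  map_smul' c x := by
    ext1 i
    fin_cases i <;>
    simp [wd_smul x.x1_mem.1, wd_smul x.x2_mem.1, wd_smul x.x3_mem.1, wd_smul x.x4_mem.1] <;> module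

lemma norm_sqrt_smul_sq {c : ℝ} (hc : 0 ≤ c) (f : L2) : ‖√c • f‖ ^ 2 = c * inner ℝ f f := by
  rw [norm_smul, mul_pow, Real.norm_of_nonneg (Real.sqrt_nonneg c), Real.sq_sqrt hc,
    real_inner_self_eq_norm_sq]

/-- The stiffness and mass forms are each diagonalised by completing the square (`quad_eq`), with
positive coefficients because both determinants are positive. -/
lemma norm_energyCoord (x : StateSpace p) : ‖energyCoord p x‖ = ‖x‖ := by
  have h1 := p.CA_pos
  have h2 := p.GA_pos
  have h3 := p.Ap_pos
  have h4 := p.ρA_pos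
  have h5 := p.ε_pos
  have h6 := p.μ_pos
  have h7 := sub_pos.2 p.CI0_sq_lt
  have h8 := sub_pos.2 p.ρI0_sq_lt
  rw [← sq_eq_sq₀ (norm_nonneg _) (norm_nonneg _), norm_sq_eq, PiLp.norm_sq_eq_of_L2,
    energyInner_self, quad_eq h1, quad_eq h4]
  simp only [energyCoord, LinearMap.coe_mk, AddHom.coe_mk, Fin.sum_univ_eight]
  change ‖√p.CA⁻¹ • (p.CA • wd x.x1 - p.CI0 • wd x.x2)‖ ^ 2
    + ‖√(p.CA⁻¹ * (p.CA * p.CI - p.CI0 ^ 2)) • wd x.x2‖ ^ 2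
    + ‖√(1 / 2 * p.GA) • (wd x.x3 - x.x2)‖ ^ 2
    + ‖√(1 / p.μ * p.Ap) • wd x.x4‖ ^ 2
    + ‖√p.ρA⁻¹ • (p.ρA • x.x5 - p.ρI0 • x.x6)‖ ^ 2
    + ‖√(p.ρA⁻¹ * (p.ρA * p.ρI - p.ρI0 ^ 2)) • x.x6‖ ^ 2
    + ‖√p.ρA • x.x7‖ ^ 2
    + ‖√(p.ε * p.Ap) • x.x8‖ ^ 2 = _
  rw [norm_sqrt_smul_sq (by positivity), norm_sqrt_smul_sq (by positivity),
    norm_sqrt_smul_sq (by positivity), norm_sqrt_smul_sq (by positivity),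
    norm_sqrt_smul_sq (by positivity), norm_sqrt_smul_sq (by positivity),
    norm_sqrt_smul_sq (by positivity), norm_sqrt_smul_sq (by positivity)]
  ring

/-- The coordinates are triangular in the strains: solve for `x₂` first, then for `x₁` and `x₃`,
which are coupled to it. Each equation prescribes a derivative and is solvable in `H10`. -/
lemma energyCoord_surjective (p : BeamParams) : Function.Surjective (energyCoord p) := by
  intro y
  have h1 := p.CA_pos
  have h2 := p.GA_pos
  have h3 := p.Ap_pos
  have h4 := p.ρA_pos
  have h5 := p.ε_pos
  have h6 := p.μ_pos
  have h7 := sub_pos.2 p.CI0_sq_lt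
  have h8 := sub_pos.2 p.ρI0_sq_lt
  have key : ∀ {c : ℝ} (_ : 0 < c) (f : L2), √c • (√c)⁻¹ • f = f := fun hc f =>
    smul_inv_smul₀ (Real.sqrt_pos.2 hc).ne' f
  have key2 : ∀ {c : ℝ} (_ : 0 < c) (f g : L2), c • c⁻¹ • (f + g) - g = f := fun hc f g => by
    rw [smul_inv_smul₀ hc.ne', add_sub_cancel_right]
  obtain ⟨f₂, m₂, e₂⟩ := exists_mem_H10_wd_eq
    ((√(p.CA⁻¹ * (p.CA * p.CI - p.CI0 ^ 2)))⁻¹ • y 1)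
  obtain ⟨f₁, m₁, e₁⟩ := exists_mem_H10_wd_eq
    (p.CA⁻¹ • ((√p.CA⁻¹)⁻¹ • y 0 + p.CI0 • wd f₂))
  obtain ⟨f₃, m₃, e₃⟩ := exists_mem_H10_wd_eq ((√(1 / 2 * p.GA))⁻¹ • y 2 + f₂)
  obtain ⟨f₄, m₄, e₄⟩ := exists_mem_H10_wd_eq ((√(1 / p.μ * p.Ap))⁻¹ • y 3)
  obtain ⟨x, a1, a2, a3, a4, a5, a6, a7, a8⟩ := exists_state p m₁ m₂ m₃ m₄
    (p.ρA⁻¹ • ((√p.ρA⁻¹)⁻¹ • y 4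
      + p.ρI0 • (√(p.ρA⁻¹ * (p.ρA * p.ρI - p.ρI0 ^ 2)))⁻¹ • y 5))
    ((√(p.ρA⁻¹ * (p.ρA * p.ρI - p.ρI0 ^ 2)))⁻¹ • y 5)
    ((√p.ρA)⁻¹ • y 6) ((√(p.ε * p.Ap))⁻¹ • y 7)
  refine ⟨x, ?_⟩
  ext1 i
  fin_cases i
  · change √p.CA⁻¹ • (p.CA • wd x.x1 - p.CI0 • wd x.x2) = y 0
    rw [a1, a2, e₁, key2 h1, key (by positivity)]
  · change √(p.CA⁻¹ * (p.CA * p.CI - p.CI0 ^ 2)) • wd x.x2 = y 1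
    rw [a2, e₂, key (by positivity)]
  · change √(1 / 2 * p.GA) • (wd x.x3 - x.x2) = y 2
    rw [a3, a2, e₃, add_sub_cancel_right, key (by positivity)]
  · change √(1 / p.μ * p.Ap) • wd x.x4 = y 3
    rw [a4, e₄, key (by positivity)]
  · change √p.ρA⁻¹ • (p.ρA • x.x5 - p.ρI0 • x.x6) = y 4
    rw [a5, a6, key2 h4, key (by positivity)]
  · change √(p.ρA⁻¹ * (p.ρA * p.ρI - p.ρI0 ^ 2)) • x.x6 = y 5
    rw [a6, key (by positivity)]
  · change √p.ρA • x.x7 = y 6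
    rw [a7, key (by positivity)]
  · change √(p.ε * p.Ap) • x.x8 = y 7
    rw [a8, key (by positivity)]

instance (p : BeamParams) : CompleteSpace (StateSpace p) :=
  let e := LinearIsometryEquiv.ofSurjective ⟨energyCoord p, norm_energyCoord⟩
    (energyCoord_surjective p)
  (completeSpace_congr (e := e.toEquiv) e.isometry.isUniformEmbedding).2 inferInstance

end Completeness

section Momentum

/-! The momentum balances and Ampère's law, encoded in the last four components of `A_T`. -/

/-- This row of the mass matrix undoes the division by `d`; the shear terms drop out since `ρA a53 =
ρI0 a63`. -/
lemma momentum_x5_x6 (x : (AT p).domain) :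
    p.ρA • (AT p x).x5 - p.ρI0 • (AT p x).x6
      = p.CA • wd (wd x.1.x1) - p.CI0 • wd (wd x.1.x2) - (p.γ * p.Ap) • wd x.1.x8 := by
  have hd := (sub_pos.2 p.ρI0_sq_lt).ne'
  change p.ρA • (p.a51 • wd (wd x.1.x1) - p.a52 • wd (wd x.1.x2) - p.a53 • x.1.x2
      + p.a53 • wd x.1.x3 - p.a58 • wd x.1.x8)
    - p.ρI0 • (- p.a61 • wd (wd x.1.x1) + p.a62 • wd (wd x.1.x2) - p.a63 • x.1.x2
      + p.a63 • wd x.1.x3 + p.a68 • wd x.1.x8) = _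
  simp only [BeamParams.a51, BeamParams.a52, BeamParams.a53, BeamParams.a58, BeamParams.a61,
    BeamParams.a62, BeamParams.a63, BeamParams.a68]
  match_scalars <;> field_simp <;> ring

lemma momentum_x6_x5 (x : (AT p).domain) :
    p.ρI • (AT p x).x6 - p.ρI0 • (AT p x).x5
      = p.CI • wd (wd x.1.x2) - p.CI0 • wd (wd x.1.x1) + (p.γ * p.I0p) • wd x.1.x8
        + (p.GA / 2) • (wd x.1.x3 - x.1.x2) := by
  have hd := (sub_pos.2 p.ρI0_sq_lt).ne'
  rw [mul_comm p.ρA] at hd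
  change p.ρI • (- p.a61 • wd (wd x.1.x1) + p.a62 • wd (wd x.1.x2) - p.a63 • x.1.x2
      + p.a63 • wd x.1.x3 + p.a68 • wd x.1.x8)
    - p.ρI0 • (p.a51 • wd (wd x.1.x1) - p.a52 • wd (wd x.1.x2) - p.a53 • x.1.x2
      + p.a53 • wd x.1.x3 - p.a58 • wd x.1.x8) = _
  simp only [BeamParams.a51, BeamParams.a52, BeamParams.a53, BeamParams.a58, BeamParams.a61,
    BeamParams.a62, BeamParams.a63, BeamParams.a68]
  match_scalars <;> field_simp <;> ring

lemma momentum_x7 (x : (AT p).domain) :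
    p.ρA • (AT p x).x7 = (p.GA / 2) • (wd (wd x.1.x3) - wd x.1.x2) := by
  have hd := p.ρA_pos.ne'
  change p.ρA • (- p.a7 • wd x.1.x2 + p.a7 • wd (wd x.1.x3)) = _
  simp only [BeamParams.a7]
  match_scalars <;> field_simp

lemma momentum_x8 (x : (AT p).domain) :
    (p.ε * p.Ap) • (AT p x).x8 = (1 / p.μ * p.Ap) • wd (wd x.1.x4)
      - (p.γ * p.Ap) • wd x.1.x5 + (p.γ * p.I0p) • wd x.1.x6 := by
  have h1 := p.ε_pos.ne'
  have h2 := p.Ap_pos.ne'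
  have h3 := p.μ_pos.ne'
  change (p.ε * p.Ap) • (p.a84 • wd (wd x.1.x4) - p.a85 • wd x.1.x5 + p.a86 • wd x.1.x6) = _
  simp only [BeamParams.a84, BeamParams.a85, BeamParams.a86]
  match_scalars <;> field_simp

end Momentum

/-! ### Energy conservation and the static problem -/

/-- The Timoshenko operator is skew-symmetric: the energy is conserved. -/
lemma inner_AT_self (x : (AT p).domain) : inner ℝ (AT p x) (x : StateSpace p) = 0 := by
  have m1 := momentum_x5_x6 x
  have m2 := momentum_x6_x5 x
  have m3 := momentum_x7 x
  have m4 := momentum_x8 x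
  obtain ⟨⟨a1, a2, a3, a4⟩, ⟨a5, a6, a7, a8⟩, b1, b2, b3, b4⟩ := x.2
  -- Every velocity is clamped at `0`, so only the boundary term at `1` remains.
  have ibp : ∀ {f g : L2}, f ∈ H1 → g ∈ H10 →
      inner ℝ (wd f) g + inner ℝ (wd g) f = trace f 1 * trace g 1 := by
    intro f g hf hg
    have h := inner_wd_add_inner_wd hf hg.1
    rw [hg.2, real_inner_comm] at h
    linarith
  have i1 := ibp a1 a5
  have i2 := ibp a2 a5
  have i3 := ibp a8.1 a5
  have i4 := ibp a2 a6
  have i5 := ibp a1 a6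
  have i6 := ibp a8.1 a6
  have i7 := ibp a3 a7
  have i8 := ibp x.1.x2_mem.1 a7
  have i9 := ibp a4 a8
  have n1 := congrArg (fun f => inner ℝ f x.1.x5) m1
  have n2 := congrArg (fun f => inner ℝ f x.1.x6) m2
  have n3 := congrArg (fun f => inner ℝ f x.1.x7) m3
  have n4 := congrArg (fun f => inner ℝ f x.1.x8) m4
  simp only [inner_sub_left, inner_add_left, real_inner_smul_left] at n1 n2 n3 n4
  rw [real_inner_comm x.1.x6 (wd x.1.x3), real_inner_comm x.1.x6 x.1.x2] at n2
  rw [inner_eq, energyInner]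
  have e1 : (AT p x).x1 = x.1.x5 := rfl
  have e2 : (AT p x).x2 = x.1.x6 := rfl
  have e3 : (AT p x).x3 = x.1.x7 := rfl
  have e4 : (AT p x).x4 = x.1.x8 := rfl
  rw [e1, e2, e3, e4]
  -- Each balance is tested with its own velocity. The boundary terms at `1` assemble into the end
  -- velocities times the four natural conditions.
  linear_combination n1 + n2 + n3 + n4 + p.CA * i1 - p.CI0 * i2 - p.γ * p.Ap * i3
    + p.CI * i4 - p.CI0 * i5 + p.γ * p.I0p * i6 + p.GA / 2 * (i7 - i8) + 1 / p.μ * p.Ap * i9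
    + trace x.1.x5 1 * b1 + trace x.1.x6 1 * b2 + trace x.1.x7 1 * b3 + trace x.1.x8 1 * b4

lemma AT_surjective (f : StateSpace p) : ∃ x : (AT p).domain, AT p x = f := by
  have hG := p.GA_pos.ne'
  have hA := p.Ap_pos.ne'
  have hμ := p.μ_pos.ne'
  have hε := p.ε_pos.ne'
  have hρ := p.ρA_pos.ne'
  have hC := (sub_pos.2 p.CI0_sq_lt).ne'
  have hd := (sub_pos.2 p.ρI0_sq_lt).ne'
  have one_mem : (1 : ℝ) ∈ Icc (0 : ℝ) 1 := by simp
  -- The `Sᵢ` are the total stresses, which the natural conditions make vanish at `1`. The shear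
  -- force `S₃` comes before the moment `S₂`, whose balance contains it. In `S₄` the velocities `x₅,
  -- x₆` are already known to be the first two components of `f`.
  obtain ⟨S₁, hS₁, dS₁, tS₁⟩ := exists_wd_eq_trace_one_eq_zero (p.ρA • f.x5 - p.ρI0 • f.x6)
  obtain ⟨S₃, hS₃, dS₃, tS₃⟩ := exists_wd_eq_trace_one_eq_zero (p.ρA • f.x7)
  obtain ⟨S₂, hS₂, dS₂, tS₂⟩ := exists_wd_eq_trace_one_eq_zero (p.ρI • f.x6 - p.ρI0 • f.x5 - S₃)
  obtain ⟨S₄, hS₄, dS₄, tS₄⟩ := exists_wd_eq_trace_one_eq_zero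
    ((p.ε * p.Ap) • f.x8 + (p.γ * p.Ap) • wd f.x1 - (p.γ * p.I0p) • wd f.x2)
  have h4 := f.x4_mem.1
  -- Removing the piezoelectric contribution, with `x₈ = f.x4` known, leaves the elastic stresses
  -- `P₁ = CA x₁' - CI0 x₂'` and `P₂ = CI x₂' - CI0 x₁'`.
  set P₁ : L2 := S₁ + (p.γ * p.Ap) • f.x4 with hP₁
  set P₂ : L2 := S₂ - (p.γ * p.I0p) • f.x4 with hP₂
  have mP₁ : P₁ ∈ H1 := H1.add_mem hS₁ (H1.smul_mem _ h4)
  have mP₂ : P₂ ∈ H1 := H1.sub_mem hS₂ (H1.smul_mem _ h4)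
  have dP₁ : wd P₁ = wd S₁ + (p.γ * p.Ap) • wd f.x4 := by
    rw [hP₁, wd_add hS₁ (H1.smul_mem _ h4), wd_smul h4]
  have dP₂ : wd P₂ = wd S₂ - (p.γ * p.I0p) • wd f.x4 := by
    rw [hP₂, wd_sub hS₂ (H1.smul_mem _ h4), wd_smul h4]
  have tP₁ : trace P₁ 1 = p.γ * p.Ap * trace f.x4 1 := by
    rw [hP₁, trace_add hS₁ (H1.smul_mem _ h4) one_mem, trace_smul h4 _ one_mem, tS₁, zero_add]
  have tP₂ : trace P₂ 1 = - (p.γ * p.I0p * trace f.x4 1) := by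
    rw [hP₂, trace_sub hS₂ (H1.smul_mem _ h4) one_mem, trace_smul h4 _ one_mem, tS₂, zero_sub]
  set D : ℝ := p.CA * p.CI - p.CI0 ^ 2 with hD
  have comb : ∀ (a b : ℝ) {u v : L2}, u ∈ H1 → v ∈ H1 → (a • u + b • v ∈ H1 ∧
      wd (a • u + b • v) = a • wd u + b • wd v ∧
      trace (a • u + b • v) 1 = a * trace u 1 + b * trace v 1) := fun a b u v hu hv =>
    ⟨H1.add_mem (H1.smul_mem a hu) (H1.smul_mem b hv), by
      rw [wd_add (H1.smul_mem a hu) (H1.smul_mem b hv), wd_smul hu, wd_smul hv], by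
      rw [trace_add (H1.smul_mem a hu) (H1.smul_mem b hv) one_mem, trace_smul hu _ one_mem,
        trace_smul hv _ one_mem]⟩
  -- Cramer's rule for the strains, `D` being the determinant of the stiffness matrix; then
  -- integration from the clamped end. The coefficient `1` in `f₃` gives that strain the shape
  -- required by `comb`.
  obtain ⟨f₁, m₁, e₁⟩ := exists_mem_H10_wd_eq ((p.CI / D) • P₁ + (p.CI0 / D) • P₂)
  obtain ⟨f₂, m₂, e₂⟩ := exists_mem_H10_wd_eq ((p.CI0 / D) • P₁ + (p.CA / D) • P₂)
  obtain ⟨f₃, m₃, e₃⟩ := exists_mem_H10_wd_eq ((1 : ℝ) • f₂ + (2 / p.GA) • S₃)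
  obtain ⟨f₄, m₄, e₄⟩ := exists_mem_H10_wd_eq ((p.μ / p.Ap) • S₄)
  obtain ⟨q₁, dq₁, tq₁⟩ := comb (p.CI / D) (p.CI0 / D) mP₁ mP₂
  obtain ⟨q₂, dq₂, tq₂⟩ := comb (p.CI0 / D) (p.CA / D) mP₁ mP₂
  obtain ⟨q₃, dq₃, tq₃⟩ := comb 1 (2 / p.GA) m₂.1 hS₃
  rw [← e₁] at q₁ dq₁ tq₁
  rw [← e₂] at q₂ dq₂ tq₂
  rw [← e₃] at q₃ dq₃ tq₃
  have q₄ : wd f₄ ∈ H1 := e₄ ▸ H1.smul_mem _ hS₄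
  have dq₄ : wd (wd f₄) = (p.μ / p.Ap) • wd S₄ := by rw [e₄, wd_smul hS₄]
  have tq₄ : trace (wd f₄) 1 = 0 := by rw [e₄, trace_smul hS₄ _ one_mem, tS₄, mul_zero]
  obtain ⟨x, a1, a2, a3, a4, a5, a6, a7, a8⟩ := exists_state p m₁ m₂ m₃ m₄ f.x1 f.x2 f.x3 f.x4
  have hx : x ∈ domAT p := by
    refine ⟨⟨a1 ▸ q₁, a2 ▸ q₂, a3 ▸ q₃, a4 ▸ q₄⟩, ⟨a5 ▸ f.x1_mem, a6 ▸ f.x2_mem, a7 ▸ f.x3_mem,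
      a8 ▸ f.x4_mem⟩, ?_, ?_, ?_, ?_⟩
    · rw [a1, a2, a8, tq₁, tq₂, tP₁, tP₂]
      field_simp
      rw [hD]; ring
    · rw [a1, a2, a8, tq₁, tq₂, tP₁, tP₂]
      field_simp
      rw [hD]; ring
    · rw [a3, a2, tq₃, tS₃]; ring
    · rw [a4, tq₄, mul_zero]
  refine ⟨⟨x, hx⟩, ?_⟩
  have n1 := momentum_x5_x6 ⟨x, hx⟩
  have n2 := momentum_x6_x5 ⟨x, hx⟩
  have n3 := momentum_x7 ⟨x, hx⟩
  have n4 := momentum_x8 ⟨x, hx⟩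
  simp only [a1, a2, a3, a4, a5, a6, a8] at n1 n2 n3 n4
  rw [dq₁, dq₂, dP₁, dP₂, dS₁, dS₂] at n1 n2
  rw [e₃] at n2
  rw [dq₃, dS₃] at n3
  rw [dq₄, dS₄] at n4
  have k0 : (AT p ⟨x, hx⟩).x1 = f.x1 ∧ (AT p ⟨x, hx⟩).x2 = f.x2 ∧ (AT p ⟨x, hx⟩).x3 = f.x3 ∧
      (AT p ⟨x, hx⟩).x4 = f.x4 := ⟨a5, a6, a7, a8⟩
  generalize AT p ⟨x, hx⟩ = y at *
  have k1 : p.ρA • y.x5 - p.ρI0 • y.x6 = p.ρA • f.x5 - p.ρI0 • f.x6 := by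
    rw [n1]
    match_scalars <;> field_simp <;> rw [hD] <;> ring
  have k2 : p.ρI • y.x6 - p.ρI0 • y.x5 = p.ρI • f.x6 - p.ρI0 • f.x5 := by
    rw [n2]
    match_scalars <;> field_simp <;> (try rw [hD]) <;> ring
  refine ext_comp k0.1 k0.2.1 k0.2.2.1 k0.2.2.2 ?_ ?_ ?_ ?_
  -- The balances fix the accelerations only through the mass matrix; multiplying by its adjugate
  -- isolates each of them, scaled by the nonzero determinant.
  · apply smul_right_injective L2 hd
    calc _ = p.ρI • (p.ρA • y.x5 - p.ρI0 • y.x6) + p.ρI0 • (p.ρI • y.x6 - p.ρI0 • y.x5) := by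
          module
      _ = _ := by rw [k1, k2]; module
  · apply smul_right_injective L2 hd
    calc _ = p.ρI0 • (p.ρA • y.x5 - p.ρI0 • y.x6) + p.ρA • (p.ρI • y.x6 - p.ρI0 • y.x5) := by
          module
      _ = _ := by rw [k1, k2]; module
  · apply smul_right_injective L2 hρ
    simp only
    rw [n3]
    match_scalars <;> field_simp <;> ring
  · apply smul_right_injective L2 (mul_ne_zero hε hA)
    simp only
    rw [n4]
    match_scalars <;> field_simp <;> ring

end Beam

end PiezoBeam

theorem mainTheorem2 (p : PiezoBeam.BeamParams) :
    CompleteSpace (PiezoBeam.StateSpace p) ∧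
      ∃ T : NNReal → (PiezoBeam.StateSpace p →L[ℝ] PiezoBeam.StateSpace p),
        PiezoBeam.IsC0Semigroup T ∧ PiezoBeam.IsGenerator (PiezoBeam.AT p) T ∧
          ∀ t, ‖T t‖ ≤ 1 :=
  ⟨inferInstance, PiezoBeam.exists_semigroup_of_skew (PiezoBeam.AT p) PiezoBeam.inner_AT_self
    PiezoBeam.AT_surjective⟩
end
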